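/- **Proposition 4.2.** Graphs are finite, without loops or multiple edges, and either undirected or directed. A circuit with $k$ edges (arcs) is a sequence of vertices $v_0,v_1,\dots,v_k$ with $v_0=v_k$ such that $\{v_{i-1},v_i\}$ (respectively $(v_{i-1},v_i)$), $i=1,\dots,k$, are pairwise distinct edges (arcs) of the graph; vertices may repeat. The problem $k$-Circuit is: given a graph $G$ with $n$ vertices and $m$ edges (arcs), as a list of its edges (arcs), and an integer $k\ge 0$, decide whether $G$ contains a circuit with exactly $k$ edges (arcs). For undirected graphs, and likewise for directed graphs, $k$-Circuit can be solved 1. by a randomized algorithm that never gives a wrong answer, in expected time $2^{O(k)}\cdot nm$ on every input, and 2. by a deterministic algorithm in worst-case time $2^{O(k)}\cdot nm\log n$. Precisely: in each of these cases there are one program for a word RAM (unit-cost arithmetic, bitwise, indirect load/store and comparison instructions on $w$-bit words; in the randomized case also fair coin tosses) and constants $c,a$ such that, for all $n$, all $G$ on the vertices $0,\dots,n-1$, every order of the list, all $k\ge 0$ and every word length $w\ge a(k+\lfloor\log_2 n\rfloor+1)$, the program solves $k$-Circuit in expected time at most $2^{c(k+1)}(nm+1)$, respectively in worst-case time at most $2^{c(k+1)}(nm\lfloor\log_2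 n\rfloor+1)$. (Here $\lfloor\log_2 0\rfloor$ is read as $0$. The added constants $1$ keep the bounds meaningful when $m=0$ or $k=0$ and are otherwise absorbed by $c$.) -/

import Mathlib

open MeasureTheory
open scoped ENNReal

/-! ## Circuits -/

/-- A circuit with `k` edges in an undirected graph: a closed walk of length `k` all of whose edges
are distinct (for `k = 0`, a single vertex). -/
def HasCircuit {V : Type} (G : SimpleGraph V) (k : ℕ) : Prop :=
  ∃ (u : V) (p : G.Walk u u), p.IsTrail ∧ p.length = k

/-- A directed circuit with `k` arcs: a sequence `v 0, …, v k` of vertices with `v 0 = v k` such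
that the pairs `(v i, v (i + 1))` are pairwise distinct arcs. -/
def HasDirectedCircuit {V : Type} (G : Digraph V) (k : ℕ) : Prop :=
  ∃ v : Fin (k + 1) → V,
    (∀ i : Fin k, G.Adj (v i.castSucc) (v i.succ)) ∧
    (Function.Injective fun i : Fin k => (v i.castSucc, v i.succ)) ∧
    v 0 = v (Fin.last k)

/-- The arc set of a directed graph. -/
def arcSet {V : Type} (G : Digraph V) : Set (V × V) := {e | G.Adj e.1 e.2}

/-! ## Graphs as inputs -/

/-- The list `es` contains every edge of the undirected graph `G` exactly once, in any order and
each edge with its two ends in any order. -/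
def ListsEdges {n : ℕ} (G : SimpleGraph (Fin n)) (es : List (Fin n × Fin n)) : Prop :=
  (es.map fun e => s(e.1, e.2)).Nodup ∧
    ∀ e : Sym2 (Fin n), e ∈ es.map (fun e => s(e.1, e.2)) ↔ e ∈ G.edgeSet

/-- The list `es` contains every arc of the directed graph `G` exactly once, in any order. -/
def ListsArcs {n : ℕ} (G : Digraph (Fin n)) (es : List (Fin n × Fin n)) : Prop :=
  es.Nodup ∧ ∀ e : Fin n × Fin n, e ∈ es ↔ e ∈ arcSet G

theorem ListsEdges.length_eq {n : ℕ} {G : SimpleGraph (Fin n)} {es : List (Fin n × Fin n)}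
    (h : ListsEdges G es) : es.length = G.edgeSet.ncard := by
  classical
  have h1 : G.edgeSet = ((es.map fun e => s(e.1, e.2)).toFinset : Set (Sym2 (Fin n))) := by
    ext e
    rw [List.coe_toFinset, Set.mem_ofPred_eq]
    exact (h.2 e).symm
  rw [h1, Set.ncard_coe_finset, List.toFinset_card_of_nodup h.1, List.length_map]

theorem ListsArcs.length_eq {n : ℕ} {G : Digraph (Fin n)} {es : List (Fin n × Fin n)}
    (h : ListsArcs G es) : es.length = (arcSet G).ncard := by
  classical
  have h1 : arcSet G = (es.toFinset : Set (Fin n × Fin n)) := by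
    ext e
    rw [List.coe_toFinset, Set.mem_ofPred_eq]
    exact (h.2 e).symm
  rw [h1, Set.ncard_coe_finset, List.toFinset_card_of_nodup h.1]

/-- The input word sequence `n, m, k, u₁, v₁, …, uₘ, vₘ`: the number of vertices, the number of
edges (arcs), the parameter, and then the list of the edges (arcs). -/
def encodeInput (n : ℕ) (es : List (Fin n × Fin n)) (k : ℕ) : List ℕ :=
  n :: es.length :: k :: es.flatMap fun e => [e.1.val, e.2.val]

/-! ## The word RAM

Words have `w` bits and are represented by the natural numbers below `2 ^ w`. There are registers
and a memory that is addressed by words. Every instruction costs one unit of time. -/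

namespace WordRAM

/-- Arithmetic and bitwise operations on words. -/
inductive Op
  | add | sub | mul | div | mod | and | or | xor | shl | shr

/-- The value of an operation on words of `w` bits (the result is reduced modulo `2 ^ w`;
division by zero gives `0`, and `x mod 0 = x`). -/
def Op.eval (w : ℕ) : Op → ℕ → ℕ → ℕ
  | .add, x, y => (x + y) % 2 ^ w
  | .sub, x, y => (x + (2 ^ w - y)) % 2 ^ w
  | .mul, x, y => (x * y) % 2 ^ w
  | .div, x, y => (x / y) % 2 ^ w
  | .mod, x, y => (x % y) % 2 ^ w
  | .and, x, y => (x &&& y) % 2 ^ w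
  | .or, x, y => (x ||| y) % 2 ^ w
  | .xor, x, y => (x ^^^ y) % 2 ^ w
  | .shl, x, y => (x <<< y) % 2 ^ w
  | .shr, x, y => (x >>> y) % 2 ^ w

/-- The instructions; `d`, `a`, `b` are register numbers and `l` is a position in the program. -/
inductive Instr
  /-- put the constant `c` into register `d` -/
  | const (d c : ℕ)
  /-- apply `o` to the registers `a` and `b` and put the result into register `d` -/
  | op (o : Op) (d a b : ℕ)
  /-- put the memory word whose address is in register `a` into register `d` -/
  | load (d a : ℕ)
  /-- write register `b` to the memory word whose address is in register `a` -/
  | store (a b : ℕ)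
  /-- continue at `l` if register `a` is less than register `b` -/
  | jlt (a b l : ℕ)
  /-- continue at `l` if the registers `a` and `b` are equal -/
  | jeq (a b l : ℕ)
  /-- put a fair random bit into register `d` -/
  | coin (d : ℕ)
  /-- stop with answer `r` (`true` is YES, `false` is NO) -/
  | halt (r : Bool)

/-- A program is a finite list of instructions. -/
abbrev Program := List Instr

/-- A program is deterministic if it never tosses a coin. -/
def Program.Deterministic (P : Program) : Prop := ∀ d : ℕ, Instr.coin d ∉ P

/-- Program counter, registers and memory. -/
structure Config where
  pc : ℕ
  reg : ℕ → ℕ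
  mem : ℕ → ℕ

/-- Execution of one instruction; `r` is the random bit that is used if it is a coin toss. -/
def exec (w : ℕ) (r : Bool) (s : Config) : Instr → Config
  | .const d c => ⟨s.pc + 1, Function.update s.reg d (c % 2 ^ w), s.mem⟩
  | .op o d a b => ⟨s.pc + 1, Function.update s.reg d (o.eval w (s.reg a) (s.reg b)), s.mem⟩
  | .load d a => ⟨s.pc + 1, Function.update s.reg d (s.mem (s.reg a)), s.mem⟩
  | .store a b => ⟨s.pc + 1, s.reg, Function.update s.mem (s.reg a) (s.reg b)⟩
  | .jlt a b l => ⟨if s.reg a < s.reg b then l else s.pc + 1, s.reg, s.mem⟩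
  | .jeq a b l => ⟨if s.reg a = s.reg b then l else s.pc + 1, s.reg, s.mem⟩
  | .coin d => ⟨s.pc + 1, Function.update s.reg d (r.toNat % 2 ^ w), s.mem⟩
  | .halt _ => s

/-- One step. Outside of the program nothing happens, and such a run never stops. -/
def step (w : ℕ) (P : Program) (r : Bool) (s : Config) : Config :=
  match P[s.pc]? with
  | some i => exec w r s i
  | none => s

/-- The initial configuration: the input stands in the first memory words, and everything else
is zero. -/
def init (w : ℕ) (x : List ℕ) : Config := ⟨0, fun _ => 0, fun i => x.getD i 0 % 2 ^ w⟩

/-- The configuration after `t` steps on input `x`, where a coin toss in step `t` (counted from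
`0`) shows `ω t`. -/
def run (w : ℕ) (P : Program) (x : List ℕ) (ω : ℕ → Bool) : ℕ → Config
  | 0 => init w x
  | t + 1 => step w P (ω t) (run w P x ω t)

/-- After `t` steps the program has stopped with answer `r`. -/
def HaltsWith (w : ℕ) (P : Program) (x : List ℕ) (ω : ℕ → Bool) (t : ℕ) (r : Bool) : Prop :=
  P[(run w P x ω t).pc]? = some (Instr.halt r)

/-- The running time: the number of steps before the program stops, `⊤` if it does not stop. -/
noncomputable def runtime (w : ℕ) (P : Program) (x : List ℕ) (ω : ℕ → Bool) : ℕ∞ :=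
  ⨅ (t : ℕ) (_ : ∃ r, HaltsWith w P x ω t r), (t : ℕ∞)

/-- The law of a sequence of independent fair coin tosses. -/
noncomputable def coinLaw : Measure (ℕ → Bool) :=
  Measure.infinitePi fun _ : ℕ => (PMF.uniformOfFintype Bool).toMeasure

/-- The expected running time. -/
noncomputable def expectedTime (w : ℕ) (P : Program) (x : List ℕ) : ℝ≥0∞ :=
  ∫⁻ ω, (runtime w P x ω : ℝ≥0∞) ∂coinLaw

/-- The randomized program `P` decides on input `x` whether `A` holds, without error, in expected
time at most `T`. -/
def DecidesInExpectedTime (w : ℕ) (P : Program) (x : List ℕ) (A : Prop) (T : ℕ) : Prop :=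
  (∀ ω t r, HaltsWith w P x ω t r → (r = true ↔ A)) ∧ expectedTime w P x ≤ T

/-- The program `P` decides on input `x` whether `A` holds in time at most `T` in the worst case. -/
def DecidesInTime (w : ℕ) (P : Program) (x : List ℕ) (A : Prop) (T : ℕ) : Prop :=
  ∀ ω, (∀ t r, HaltsWith w P x ω t r → (r = true ↔ A)) ∧ runtime w P x ω ≤ T

end WordRAM

/-!
One deterministic program, in a directed and an undirected version, runs in time
`2 ^ O(k) * (n * m + 1)`. This gives all four claims: no coins are tossed, so the expected time is
the worst-case time, and the factor `log n` is not needed.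

Label the edges by `0, …, m - 1`; the two arcs that an undirected edge gives get the same label. A
circuit with `k` edges is a closed walk with `k` arcs and distinct labels `t₁, …, tₖ`
(`hasDirectedCircuit_iff`, `hasCircuit_iff`), and the labels are distinct if and only if the
Vandermonde determinant `det (tᵢ ^ j)` does not vanish. Hence there is a circuit through the vertex
`s` if and only if the sum of the *squares* of these determinants over all closed walks of length
`k` at `s` is not zero: nothing can cancel (`walkSum_range_ne_zero_iff`).

This sum is found by dynamic programming over pairs `(A, B)` of sets of columns. Let
`walkSum s A B v` be the sum, over all walks from `s` to `v` with `#A` arcs, of the product of the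
Vandermonde minors with columns `A` and with columns `B`. Expanding both minors along the row of the
last arc gives a recurrence (`walkSum_eq`) that costs `O(k ^ 2)` operations for each arc and each of
the `4 ^ k` pairs, so `2 ^ O(k) * n * m` for all start vertices. The pair `(A, B)` is stored as a
mask of `2 * k` bits, and removing columns makes the mask smaller, so that the masks can be treated
in increasing order.

The numbers do not fit into a word. They are below `(2 * m * k) ^ (5 * k ^ 2)`, and the program
works modulo each of the `5 * k ^ 2 + 1` consecutive numbers from `x = O(k ^ 3 * m)` on. If all of
`x, …, x + r` divide `N`, then `x * (x + 1) * ⋯ * (x + r)` divides `N * r!`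
(`Nat.ascFactorial_dvd_mul_factorial`), so a number `N` below the bound that vanishes modulo all of
them is zero (`Nat.eq_zero_of_forall_add_dvd`). No primes have to be found.

The program is written in a small language with branches and counted loops, whose compilation to the
word RAM is verified together with a bound for the running time (`WordRAM.Cmd.exists_iterate_step`).
-/

/-! ### A structured language and its compilation -/

namespace WordRAM

/-- Registers and memory, without the program counter. -/
@[ext] structure State where
  reg : ℕ → ℕ
  mem : ℕ → ℕ

/-- Overwrite register `d` by `x`. -/
def State.set (s : State) (d x : ℕ) : State := ⟨Function.update s.reg d x, s.mem⟩

@[simp] theorem State.set_mem (s : State) (d x : ℕ) : (s.set d x).mem = s.mem := rfl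

theorem State.set_reg (s : State) (d x r : ℕ) :
    (s.set d x).reg r = if r = d then x else s.reg r := by
  simp [State.set, Function.update_apply]

/-- Structured commands: single instructions, sequencing, a branch on the equality of two
registers, and `loop i n c`, which executes `c` with register `i` running through `0, 1, …` until
it reaches the value of register `n`. -/
inductive Cmd
  | skip
  | const (d c : ℕ)
  | op (o : Op) (d a b : ℕ)
  | load (d a : ℕ)
  | store (a b : ℕ)
  | seq (c₁ c₂ : Cmd)
  | ite (a b : ℕ) (c₁ c₂ : Cmd)
  | loop (i n : ℕ) (c : Cmd)

/-- The state at the loop head when the counter `i` has the value `j`, for a loop body with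
effect `f`. -/
def iter (f : State → State) (i : ℕ) (s : State) : ℕ → State
  | 0 => s.set i 0
  | j + 1 => (f (iter f i s j)).set i (j + 1)

namespace Cmd

/-- The effect of a command on words of `w` bits. -/
def eval (w : ℕ) : Cmd → State → State
  | skip => fun s => s
  | const d c => fun s => s.set d (c % 2 ^ w)
  | op o d a b => fun s => s.set d (o.eval w (s.reg a) (s.reg b))
  | load d a => fun s => s.set d (s.mem (s.reg a))
  | store a b => fun s => ⟨s.reg, Function.update s.mem (s.reg a) (s.reg b)⟩
  | seq c₁ c₂ => fun s => eval w c₂ (eval w c₁ s)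
  | ite a b c₁ c₂ => fun s => if s.reg a = s.reg b then eval w c₁ s else eval w c₂ s
  | loop i n c => fun s => iter (eval w c) i s (s.reg n)

theorem eval_const (w d c : ℕ) (s : State) : (const d c).eval w s = s.set d (c % 2 ^ w) := rfl

theorem eval_op (w : ℕ) (o : Op) (d a b : ℕ) (s : State) :
    (op o d a b).eval w s = s.set d (o.eval w (s.reg a) (s.reg b)) := rfl

theorem eval_load (w d a : ℕ) (s : State) :
    (load d a).eval w s = s.set d (s.mem (s.reg a)) := rfl

theorem eval_store (w a b : ℕ) (s : State) :
    (store a b).eval w s = ⟨s.reg, Function.update s.mem (s.reg a) (s.reg b)⟩ := rfl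

theorem eval_ite (w a b : ℕ) (c₁ c₂ : Cmd) (s : State) :
    (ite a b c₁ c₂).eval w s = if s.reg a = s.reg b then c₁.eval w s else c₂.eval w s := rfl

/-- The number of instructions of the compiled command. -/
def len : Cmd → ℕ
  | skip => 0
  | const _ _ => 1
  | op _ _ _ _ => 1
  | load _ _ => 1
  | store _ _ => 1
  | seq c₁ c₂ => len c₁ + len c₂
  | ite _ _ c₁ c₂ => len c₂ + len c₁ + 2
  | loop _ _ c => len c + 4

/-- The compiled command, to be placed at position `o` of a program. Loops use register `0` as the
increment, which therefore has to hold the value `1`. -/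
def code : Cmd → ℕ → List Instr
  | skip, _ => []
  | const d c, _ => [.const d c]
  | op o d a b, _ => [.op o d a b]
  | load d a, _ => [.load d a]
  | store a b, _ => [.store a b]
  | seq c₁ c₂, o => code c₁ o ++ code c₂ (o + len c₁)
  | ite a b c₁ c₂, o =>
    .jeq a b (o + len c₂ + 2) :: (code c₂ (o + 1) ++
      .jeq 0 0 (o + len c₂ + len c₁ + 2) :: code c₁ (o + len c₂ + 2))
  | loop i n c, o =>
    .const i 0 :: .jeq i n (o + len c + 4) :: (code c (o + 2) ++
      [.op .add i i 0, .jeq 0 0 (o + 1)])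

theorem length_code (c : Cmd) (o : ℕ) : (c.code o).length = c.len := by
  induction c generalizing o <;> simp [code, len, *]
  omega

theorem coin_notMem_code (c : Cmd) (o d : ℕ) : Instr.coin d ∉ c.code o := by
  induction c generalizing o <;> simp [code, *]

/-- The registers that a command may change. -/
def writes : Cmd → List ℕ
  | skip => []
  | const d _ => [d]
  | op _ d _ _ => [d]
  | load d _ => [d]
  | store _ _ => []
  | seq c₁ c₂ => writes c₁ ++ writes c₂
  | ite _ _ c₁ c₂ => writes c₁ ++ writes c₂
  | loop i _ c => i :: writes c

/-- The command never writes to the memory. -/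
def Storeless : Cmd → Prop
  | store _ _ => False
  | seq c₁ c₂ => Storeless c₁ ∧ Storeless c₂
  | ite _ _ c₁ c₂ => Storeless c₁ ∧ Storeless c₂
  | loop _ _ c => Storeless c
  | _ => True

theorem eval_reg_of_notMem_writes (w : ℕ) (c : Cmd) {r : ℕ} (hr : r ∉ c.writes) (s : State) :
    (c.eval w s).reg r = s.reg r := by
  induction c generalizing s with
  | skip => rfl
  | const | op | load | store => simp_all [writes, eval, State.set_reg]
  | seq c₁ c₂ h₁ h₂ => simp_all [writes, eval]
  | ite a b c₁ c₂ h₁ h₂ =>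
    simp only [writes, List.mem_append, not_or] at hr
    simp only [eval]
    split_ifs
    exacts [h₁ hr.1 s, h₂ hr.2 s]
  | loop i n c h =>
    simp only [writes, List.mem_cons, not_or] at hr
    have key : ∀ j, (iter (eval w c) i s j).reg r = s.reg r := by
      intro j
      induction j with
      | zero => simp [iter, State.set_reg, hr.1]
      | succ j ih => simp [iter, State.set_reg, hr.1, h hr.2, ih]
    exact key _

theorem eval_mem_of_storeless (w : ℕ) (c : Cmd) (hc : c.Storeless) (s : State) :
    (c.eval w s).mem = s.mem := by
  induction c generalizing s with
  | skip => rfl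
  | const | op | load => rfl
  | store => exact hc.elim
  | seq c₁ c₂ h₁ h₂ => simp [eval, h₂ hc.2, h₁ hc.1]
  | ite a b c₁ c₂ h₁ h₂ =>
    simp only [eval]
    split_ifs
    exacts [h₁ hc.1 s, h₂ hc.2 s]
  | loop i n c h =>
    have key : ∀ j, (iter (eval w c) i s j).mem = s.mem := by
      intro j
      induction j with
      | zero => simp [iter]
      | succ j ih => simp [iter, h hc, ih]
    exact key _

/-- The invariant rule for loops; the registers that neither the loop nor its body writes keep
their values throughout. -/
theorem loop_induction {w i n : ℕ} {c : Cmd} {s : State} (Inv : ℕ → State → Prop)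
    (h0 : Inv 0 (s.set i 0))
    (hs : ∀ j < s.reg n, ∀ s' : State, (∀ r ∉ i :: c.writes, s'.reg r = s.reg r) → s'.reg i = j →
      Inv j s' → Inv (j + 1) ((c.eval w s').set i (j + 1))) :
    Inv (s.reg n) ((loop i n c).eval w s) := by
  have key : ∀ j ≤ s.reg n, (∀ r ∉ i :: c.writes, (iter (eval w c) i s j).reg r = s.reg r) ∧
      (iter (eval w c) i s j).reg i = j ∧ Inv j (iter (eval w c) i s j) := by
    intro j
    induction j with
    | zero =>
      intro _
      refine ⟨fun r hr => ?_, by simp [iter, State.set_reg], h0⟩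
      simp only [List.mem_cons, not_or] at hr
      simp [iter, State.set_reg, hr.1]
    | succ j ih =>
      intro hj
      obtain ⟨h1, h2, h3⟩ := ih (by omega)
      refine ⟨fun r hr => ?_, by simp [iter, State.set_reg], hs j (by omega) _ h1 h2 h3⟩
      have hr' := h1 r hr
      simp only [List.mem_cons, not_or] at hr
      simp [iter, State.set_reg, hr.1, eval_reg_of_notMem_writes w c hr.2, hr']
  exact (key _ le_rfl).2.2

/-- The command never writes to a register in `L`, and all its loops are bounded by registers in
`L`, use register `0`, which is in `L`, as increment, and do not change their counter otherwise. -/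
def Bounded (L : List ℕ) : Cmd → Prop
  | skip => True
  | const d _ => d ∉ L
  | op _ d _ _ => d ∉ L
  | load d _ => d ∉ L
  | store _ _ => True
  | seq c₁ c₂ => Bounded L c₁ ∧ Bounded L c₂
  | ite _ _ c₁ c₂ => Bounded L c₁ ∧ Bounded L c₂
  | loop i n c => i ∉ L ∧ n ∈ L ∧ 0 ∈ L ∧ i ∉ c.writes ∧ Bounded L c

theorem Bounded.notMem_writes {L : List ℕ} {c : Cmd} (h : c.Bounded L) {r : ℕ} (hr : r ∈ L) :
    r ∉ c.writes := by
  induction c with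
  | skip | store => simp [writes]
  | const | op | load => simp only [writes, List.mem_singleton]; rintro rfl; exact h hr
  | seq c₁ c₂ h₁ h₂ => simp [writes, h₁ h.1, h₂ h.2]
  | ite a b c₁ c₂ h₁ h₂ => simp [writes, h₁ h.1, h₂ h.2]
  | loop i n c ih =>
    simp only [writes, List.mem_cons, not_or]
    exact ⟨by rintro rfl; exact h.1 hr, ih h.2.2.2.2⟩

/-- An upper bound for the running time of a bounded command when the loop bounds are given
by `ρ`. -/
def cost (ρ : ℕ → ℕ) : Cmd → ℕ
  | skip => 0
  | const _ _ => 1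
  | op _ _ _ _ => 1
  | load _ _ => 1
  | store _ _ => 1
  | seq c₁ c₂ => cost ρ c₁ + cost ρ c₂
  | ite _ _ c₁ c₂ => cost ρ c₁ + cost ρ c₂ + 2
  | loop _ n c => 2 + ρ n * (cost ρ c + 3)

end Cmd

/-- The instructions `l` stand in the program `P` from position `o` on. -/
def CodeAt (P : Program) (o : ℕ) (l : List Instr) : Prop :=
  ∀ i < l.length, P[o + i]? = l[i]?

theorem CodeAt.left {P : Program} {o : ℕ} {l₁ l₂ : List Instr} (h : CodeAt P o (l₁ ++ l₂)) :
    CodeAt P o l₁ := by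
  intro i hi
  rw [h i (by simp; omega), List.getElem?_append_left hi]

theorem CodeAt.right {P : Program} {o : ℕ} {l₁ l₂ : List Instr} (h : CodeAt P o (l₁ ++ l₂)) :
    CodeAt P (o + l₁.length) l₂ := by
  intro i hi
  rw [Nat.add_assoc, h _ (by simp; omega), List.getElem?_append_right (by omega)]
  simp

theorem CodeAt.head {P : Program} {o : ℕ} {i : Instr} {l : List Instr} (h : CodeAt P o (i :: l)) :
    P[o]? = some i := by
  simpa using h 0 (by simp)

theorem CodeAt.tail {P : Program} {o : ℕ} {i : Instr} {l : List Instr} (h : CodeAt P o (i :: l)) :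
    CodeAt P (o + 1) l :=
  CodeAt.right (l₁ := [i]) h

theorem step_of_getElem? {w : ℕ} {P : Program} {r : Bool} {s : Config} {i : Instr}
    (h : P[s.pc]? = some i) : step w P r s = exec w r s i := by
  simp [step, h]

/-- Correctness of the compilation: the compiled code has the effect of the command and takes at
most the time given by `Cmd.cost`. -/
theorem Cmd.exists_iterate_step {w : ℕ} {P : Program} {L : List ℕ} {ρ : ℕ → ℕ}
    (hρ : ∀ r ∈ L, ρ r < 2 ^ w) (hρ0 : 0 ∈ L → ρ 0 = 1) (c : Cmd) (hc : c.Bounded L) (o : ℕ)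
    (hP : CodeAt P o (c.code o)) (s : State) (hs : ∀ r ∈ L, s.reg r = ρ r) :
    ∃ t ≤ c.cost ρ, (step w P false)^[t] ⟨o, s.reg, s.mem⟩ =
      ⟨o + c.len, (c.eval w s).reg, (c.eval w s).mem⟩ := by
  induction c generalizing o s with
  | skip => exact ⟨0, le_rfl, rfl⟩
  | const | op | load | store =>
    refine ⟨1, le_rfl, ?_⟩
    simp only [Function.iterate_one]
    rw [step_of_getElem? (s := ⟨o, s.reg, s.mem⟩) hP.head]
    rfl
  | seq c₁ c₂ h₁ h₂ =>
    obtain ⟨t₁, ht₁, e₁⟩ := h₁ hc.1 o hP.left s hs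
    have hP₂ := hP.right
    rw [length_code] at hP₂
    obtain ⟨t₂, ht₂, e₂⟩ := h₂ hc.2 _ hP₂ (c₁.eval w s) fun r hr => by
      rw [eval_reg_of_notMem_writes w c₁ (hc.1.notMem_writes hr), hs r hr]
    refine ⟨t₂ + t₁, by simp only [cost]; omega, ?_⟩
    rw [Function.iterate_add_apply, e₁, e₂, len, Nat.add_assoc]
    rfl
  | ite a b c₁ c₂ h₁ h₂ =>
    by_cases hab : s.reg a = s.reg b
    · have hP₁ := hP.tail.right.tail
      rw [length_code] at hP₁
      rw [show o + 1 + c₂.len + 1 = o + c₂.len + 2 by omega] at hP₁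
      obtain ⟨t, ht, e⟩ := h₁ hc.1 _ hP₁ s hs
      refine ⟨t + 1, by simp only [cost]; omega, ?_⟩
      rw [Function.iterate_succ_apply, step_of_getElem? (s := ⟨o, s.reg, s.mem⟩) hP.head]
      simp only [exec, hab, if_true, e, len, eval]
      congr 1
      omega
    · obtain ⟨t, ht, e⟩ := h₂ hc.2 _ hP.tail.left s hs
      refine ⟨1 + t + 1, by simp only [cost]; omega, ?_⟩
      have hP₁ := hP.tail.right.head
      rw [length_code] at hP₁
      rw [Function.iterate_succ_apply, step_of_getElem? (s := ⟨o, s.reg, s.mem⟩) hP.head]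
      simp only [exec, hab, if_false]
      rw [Function.iterate_add_apply, e, Function.iterate_one,
        step_of_getElem? (s := ⟨o + 1 + c₂.len, _, _⟩) hP₁]
      simp only [exec, if_true, len, eval, hab, if_false]
      congr 1
      omega
  | loop i n c ih =>
    obtain ⟨hi, hn, h0, hiw, hc'⟩ := hc
    have hj0 := hP.tail.head
    have hend := hP.tail.tail.right
    rw [length_code] at hend
    -- the state at the loop head after `j` rounds
    have key : ∀ j ≤ s.reg n, (∀ r ∈ L, (iter (eval w c) i s j).reg r = ρ r) ∧
        (iter (eval w c) i s j).reg i = j ∧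
        ∃ t ≤ 1 + j * (c.cost ρ + 3), (step w P false)^[t] ⟨o, s.reg, s.mem⟩ =
          ⟨o + 1, (iter (eval w c) i s j).reg, (iter (eval w c) i s j).mem⟩ := by
      intro j
      induction j with
      | zero =>
        intro _
        refine ⟨fun r hr => ?_, by simp [iter, State.set_reg], 1, by simp, ?_⟩
        · have : r ≠ i := by rintro rfl; exact hi hr
          simp [iter, State.set_reg, this, hs r hr]
        · rw [Function.iterate_one, step_of_getElem? (s := ⟨o, s.reg, s.mem⟩) hP.head]
          simp [exec, iter, State.set]
      | succ j ihj =>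
        intro hj
        obtain ⟨a1, a2, t, ht, e⟩ := ihj (by omega)
        have a1' : ∀ r ∈ L, (iter (eval w c) i s (j + 1)).reg r = ρ r := fun r hr => by
          have : r ≠ i := by rintro rfl; exact hi hr
          simp [iter, State.set_reg, this, eval_reg_of_notMem_writes w c (hc'.notMem_writes hr),
            a1 r hr]
        refine ⟨a1', by simp [iter, State.set_reg], ?_⟩
        obtain ⟨t', ht', e'⟩ := ih hc' (o + 2) hP.tail.tail.left _ a1
        refine ⟨1 + (1 + (t' + (1 + t))), ?_, ?_⟩
        · rw [Nat.succ_mul]; omega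
        · have hne : (iter (eval w c) i s j).reg i ≠ (iter (eval w c) i s j).reg n := by
            rw [a2, a1 n hn, ← hs n hn]; omega
          have hlt : j + 1 < 2 ^ w := lt_of_le_of_lt hj (by rw [hs n hn]; exact hρ n hn)
          have b0 : (eval w c (iter (eval w c) i s j)).reg 0 = 1 := by
            rw [eval_reg_of_notMem_writes w c (hc'.notMem_writes h0), a1 0 h0, hρ0 h0]
          have bi : (eval w c (iter (eval w c) i s j)).reg i = j := by
            rw [eval_reg_of_notMem_writes w c hiw, a2]
          simp only [Function.iterate_add_apply, Function.iterate_one]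
          rw [e, step_of_getElem? (s := ⟨o + 1, _, _⟩) hj0]
          simp only [exec, hne, if_false]
          rw [e', step_of_getElem? (s := ⟨o + 2 + c.len, _, _⟩) hend.head]
          simp only [exec, Op.eval, bi, b0, Nat.mod_eq_of_lt hlt]
          rw [step_of_getElem? (s := ⟨o + 2 + c.len + 1, _, _⟩) hend.tail.head]
          simp [exec, iter, State.set]
    obtain ⟨a1, a2, t, ht, e⟩ := key _ le_rfl
    refine ⟨1 + t, ?_, ?_⟩
    · simp only [cost, ← hs n hn]; omega
    · rw [Function.iterate_add_apply, e, Function.iterate_one,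
        step_of_getElem? (s := ⟨o + 1, _, _⟩) hj0]
      have : (iter (eval w c) i s (s.reg n)).reg i = (iter (eval w c) i s (s.reg n)).reg n := by
        rw [a2, a1 n hn, hs n hn]
      simp only [exec, this, if_true, eval, len]
      rfl

/-! ### Runs of deterministic programs -/

theorem step_eq_step_false {w : ℕ} {P : Program} (hP : P.Deterministic) (r : Bool) (s : Config) :
    step w P r s = step w P false s := by
  unfold step
  cases h : P[s.pc]? with
  | none => rfl
  | some i =>
    cases i with
    | coin d => exact absurd (List.mem_of_getElem? h) (hP d)
    | _ => rfl

theorem run_eq_iterate {w : ℕ} {P : Program} (hP : P.Deterministic) (x : List ℕ) (ω : ℕ → Bool)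
    (t : ℕ) : run w P x ω t = (step w P false)^[t] (init w x) := by
  induction t with
  | zero => rfl
  | succ t ih => rw [run, ih, step_eq_step_false hP, Function.iterate_succ_apply']

theorem HaltsWith.run_eq {w : ℕ} {P : Program} {x : List ℕ} {ω : ℕ → Bool} {t : ℕ} {r : Bool}
    (h : HaltsWith w P x ω t r) {t' : ℕ} (ht : t ≤ t') : run w P x ω t' = run w P x ω t := by
  induction t', ht using Nat.le_induction with
  | base => rfl
  | succ t' _ ih =>
    rw [run, ih, step_of_getElem? h]
    rfl

theorem HaltsWith.unique {w : ℕ} {P : Program} {x : List ℕ} {ω : ℕ → Bool} {t t' : ℕ}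
    {r r' : Bool} (h : HaltsWith w P x ω t r) (h' : HaltsWith w P x ω t' r') : r = r' := by
  have key : ∀ {t t' : ℕ} {r r' : Bool}, t ≤ t' → HaltsWith w P x ω t r →
      HaltsWith w P x ω t' r' → r = r' := by
    intro t t' r r' ht h h'
    unfold HaltsWith at h'
    rw [h.run_eq ht, h] at h'
    simpa using h'
  rcases le_total t t' with ht | ht
  exacts [key ht h h', (key ht h' h).symm]

theorem decidesInTime_of_haltsWith {w : ℕ} {P : Program} {x : List ℕ} {A : Prop} {T : ℕ}
    (h : ∀ ω, ∃ t ≤ T, ∃ r, HaltsWith w P x ω t r ∧ (r = true ↔ A)) : DecidesInTime w P x A T := by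
  intro ω
  obtain ⟨t, ht, r, hr, hA⟩ := h ω
  refine ⟨fun t' r' h' => by rw [h'.unique hr, hA], ?_⟩
  refine (iInf₂_le t ⟨r, hr⟩).trans ?_
  exact_mod_cast ht

instance : IsProbabilityMeasure coinLaw := by
  unfold coinLaw
  infer_instance

theorem DecidesInTime.decidesInExpectedTime {w : ℕ} {P : Program} {x : List ℕ} {A : Prop} {T : ℕ}
    (h : DecidesInTime w P x A T) : DecidesInExpectedTime w P x A T := by
  refine ⟨fun ω => (h ω).1, ?_⟩
  calc expectedTime w P x ≤ ∫⁻ _, (T : ℝ≥0∞) ∂coinLaw :=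
        lintegral_mono fun ω => by simpa using ENat.toENNReal_le.2 (h ω).2
    _ = T := by simp

theorem DecidesInTime.mono {w : ℕ} {P : Program} {x : List ℕ} {A : Prop} {T T' : ℕ}
    (h : DecidesInTime w P x A T) (hT : T ≤ T') : DecidesInTime w P x A T' :=
  fun ω => ⟨(h ω).1, (h ω).2.trans (by exact_mod_cast hT)⟩

end WordRAM

/-! ### Vandermonde minors -/

open Finset in
/-- The signed coefficient of the column `a ∈ A` in the expansion of a Vandermonde minor with
columns `A` along a row with node `t`. -/
def rowCoeff (t : ℕ) (A : Finset ℕ) (a : ℕ) : ℤ := (-1) ^ #{b ∈ A | b < a} * (t : ℤ) ^ a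

/-- The minor with columns `A` of the Vandermonde matrix with rows `(1, t, t ^ 2, …)` for the
nodes `t ∈ l`, defined by expansion along the first row (and `0` if the minor is not square). -/
def vandermondeMinor : List ℕ → Finset ℕ → ℤ
  | [], A => if A = ∅ then 1 else 0
  | t :: l, A => ∑ a ∈ A, rowCoeff t A a * vandermondeMinor l (A.erase a)

/-- The recursive definition agrees with the determinant: Laplace expansion along the first row, the
columns being enumerated in increasing order by `f`. -/
theorem vandermondeMinor_ofFn {n : ℕ} (t f : Fin n → ℕ) (hf : StrictMono f) :
    vandermondeMinor (List.ofFn t) (Finset.univ.image f) =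
      (Matrix.of fun i j => (t i : ℤ) ^ f j).det := by
  induction n with
  | zero => simp [vandermondeMinor]
  | succ n ih =>
    rw [List.ofFn_succ, vandermondeMinor, Finset.sum_image fun _ _ _ _ h => hf.injective h,
      Matrix.det_succ_row_zero]
    refine Finset.sum_congr rfl fun j _ => ?_
    have h1 : Finset.card {b ∈ Finset.univ.image f | b < f j} = (j : ℕ) := by
      rw [Finset.filter_image, Finset.card_image_of_injective _ hf.injective]
      simp only [hf.lt_iff_lt]
      rw [← Fin.card_Iio j]
      congr 1
      ext x
      simp
    have h2 : (Finset.univ.image f).erase (f j) = Finset.univ.image (f ∘ j.succAbove) := by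
      ext x
      simp only [Finset.mem_erase, Finset.mem_image, Finset.mem_univ, true_and]
      constructor
      · rintro ⟨hx, i, rfl⟩
        obtain ⟨y, hy⟩ := Fin.exists_succAbove_eq (x := i) (y := j) (by rintro rfl; exact hx rfl)
        exact ⟨y, by rw [Function.comp_apply, hy]⟩
      · rintro ⟨i, rfl⟩
        exact ⟨fun h => Fin.succAbove_ne j i (hf.injective h), _, rfl⟩
    rw [rowCoeff, h1, h2, ih _ _ (hf.comp (Fin.strictMono_succAbove j))]
    rfl

/-- The square minor with columns `0, …, k - 1` is the Vandermonde determinant, which vanishes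
exactly if two nodes agree. -/
theorem vandermondeMinor_range_ne_zero_iff (l : List ℕ) :
    vandermondeMinor l (Finset.range l.length) ≠ 0 ↔ l.Nodup := by
  have h1 : Finset.range l.length = Finset.univ.image (fun i : Fin l.length => (i : ℕ)) := by
    ext x
    simp only [Finset.mem_range, Finset.mem_image, Finset.mem_univ, true_and]
    exact ⟨fun h => ⟨⟨x, h⟩, rfl⟩, by rintro ⟨i, rfl⟩; exact i.2⟩
  have h2 := vandermondeMinor_ofFn l.get (fun i : Fin l.length => (i : ℕ)) Fin.val_strictMono
  have h3 : (Matrix.of fun i j : Fin l.length => ((l.get i : ℕ) : ℤ) ^ (j : ℕ)) =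
      Matrix.vandermonde fun i => ((l.get i : ℕ) : ℤ) := rfl
  rw [List.ofFn_get, ← h1, h3] at h2
  rw [h2, Matrix.det_vandermonde_ne_zero_iff, List.nodup_iff_injective_get]
  exact ⟨fun h i j hij => h (by simp only [hij]), fun h i j hij => h (Int.ofNat_inj.1 hij)⟩

theorem abs_vandermondeMinor_le {k m : ℕ} (hm : 0 < m) (l : List ℕ) (hl : ∀ t ∈ l, t ≤ m)
    (A : Finset ℕ) (hA : A ⊆ Finset.range k) :
    |vandermondeMinor l A| ≤ ((k * m ^ k) ^ l.length : ℕ) := by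
  induction l generalizing A with
  | nil => rw [vandermondeMinor]; split_ifs <;> simp
  | cons t l ih =>
    rw [vandermondeMinor]
    have hterm : ∀ a ∈ A, |rowCoeff t A a * vandermondeMinor l (A.erase a)| ≤
        (m ^ k * (k * m ^ k) ^ l.length : ℕ) := by
      intro a ha
      rw [abs_mul, Nat.cast_mul]
      refine mul_le_mul ?_ (ih (fun t ht => hl t (by simp [ht])) _
        ((A.erase_subset a).trans hA)) (abs_nonneg _) (by positivity)
      rw [rowCoeff, abs_mul, abs_pow, abs_neg, abs_one, one_pow, one_mul, abs_pow, Nat.abs_cast]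
      have h1 : t ^ a ≤ m ^ k := (Nat.pow_le_pow_left (hl t (by simp)) a).trans
        (Nat.pow_le_pow_right hm (Finset.mem_range.1 (hA ha)).le)
      exact_mod_cast h1
    calc |∑ a ∈ A, rowCoeff t A a * vandermondeMinor l (A.erase a)|
        ≤ ∑ a ∈ A, |rowCoeff t A a * vandermondeMinor l (A.erase a)| :=
          Finset.abs_sum_le_sum_abs _ _
      _ ≤ A.card • ((m ^ k * (k * m ^ k) ^ l.length : ℕ) : ℤ) :=
          Finset.sum_le_card_nsmul _ _ _ hterm
      _ ≤ ((k * m ^ k) ^ (t :: l).length : ℕ) := by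
          have hc : A.card ≤ k := by simpa using Finset.card_le_card hA
          rw [nsmul_eq_mul, ← Nat.cast_mul, List.length_cons, pow_succ' (k * m ^ k), mul_assoc k]
          exact_mod_cast Nat.mul_le_mul_right _ hc

/-! ### Sums over walks -/

/-- An arc with its label. -/
structure Arc where
  src : ℕ
  tgt : ℕ
  label : ℕ

/-- The label sequences, last label first, of the walks with `i` arcs from `s` to `v`. -/
def walks (arcs : List Arc) (s : ℕ) : ℕ → ℕ → List (List ℕ)
  | 0, v => if v = s then [[]] else []
  | i + 1, v => arcs.flatMap fun a =>
      if a.tgt = v then (walks arcs s i a.src).map (a.label :: ·) else []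

/-- The sum, over all walks with `#A` arcs from `s` to `v`, of the product of the Vandermonde minors
with columns `A` and `B` of its labels. -/
def walkSum (arcs : List Arc) (s : ℕ) (A B : Finset ℕ) (v : ℕ) : ℤ :=
  ((walks arcs s A.card v).map fun l => vandermondeMinor l A * vandermondeMinor l B).sum

theorem List.sum_map_sum_mul_sum {ι : Type*} (L : List ι) (A B : Finset ℕ) (p q : ℕ → ℤ)
    (u v : ℕ → ι → ℤ) :
    (L.map fun l => (∑ x ∈ A, p x * u x l) * ∑ y ∈ B, q y * v y l).sum =
      ∑ x ∈ A, ∑ y ∈ B, p x * q y * (L.map fun l => u x l * v y l).sum := by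
  induction L with
  | nil => simp
  | cons l L ih =>
    simp only [List.map_cons, List.sum_cons, ih, mul_add, Finset.sum_add_distrib]
    rw [Finset.sum_mul_sum]
    congr 1
    refine Finset.sum_congr rfl fun x _ => Finset.sum_congr rfl fun y _ => ?_
    ring

/-- The recurrence that the program evaluates. -/
theorem walkSum_eq (arcs : List Arc) (s : ℕ) (A B : Finset ℕ) (v : ℕ) :
    walkSum arcs s A B v = (if v = s ∧ A = ∅ ∧ B = ∅ then 1 else 0) +
      (arcs.map fun a => if a.tgt = v then
        ∑ x ∈ A, ∑ y ∈ B, rowCoeff a.label A x * rowCoeff a.label B y *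
          walkSum arcs s (A.erase x) (B.erase y) a.src else 0).sum := by
  rcases A.eq_empty_or_nonempty with rfl | hA
  · by_cases hv : v = s <;> by_cases hB : B = ∅ <;>
      simp [walkSum, walks, vandermondeMinor, hv, hB]
  · obtain ⟨i, hi⟩ := Nat.exists_eq_succ_of_ne_zero (Finset.card_ne_zero.2 hA)
    have hA' : A ≠ ∅ := hA.ne_empty
    simp only [hA', false_and, and_false, if_false, zero_add]
    rw [walkSum, hi, walks, List.map_flatMap, List.flatMap, List.sum_flatten, List.map_map]
    congr 1
    refine List.map_congr_left fun a _ => ?_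
    rw [Function.comp_apply]
    split_ifs with h
    · rw [List.map_map]
      simp only [Function.comp_def, vandermondeMinor]
      rw [List.sum_map_sum_mul_sum (walks arcs s i a.src) A B (rowCoeff a.label A)
        (rowCoeff a.label B) (fun x l => vandermondeMinor l (A.erase x))
        (fun y l => vandermondeMinor l (B.erase y))]
      refine Finset.sum_congr rfl fun x hx => Finset.sum_congr rfl fun y _ => ?_
      rw [walkSum, Finset.card_erase_of_mem hx, hi]
      rfl
    · rfl

theorem length_of_mem_walks {arcs : List Arc} {s i v : ℕ} {l : List ℕ}
    (h : l ∈ walks arcs s i v) : l.length = i := by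
  induction i generalizing v l with
  | zero => rw [walks] at h; split_ifs at h <;> simp_all
  | succ i ih =>
    simp only [walks, List.mem_flatMap] at h
    obtain ⟨a, _, h⟩ := h
    split_ifs at h
    · obtain ⟨l', hl', rfl⟩ := List.mem_map.1 h
      simp [ih hl']
    · simp at h

theorem le_of_mem_of_mem_walks {arcs : List Arc} {m s i v : ℕ} (harcs : ∀ a ∈ arcs, a.label ≤ m)
    {l : List ℕ} (h : l ∈ walks arcs s i v) : ∀ t ∈ l, t ≤ m := by
  induction i generalizing v l with
  | zero => rw [walks] at h; split_ifs at h <;> simp_all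
  | succ i ih =>
    simp only [walks, List.mem_flatMap] at h
    obtain ⟨a, ha, h⟩ := h
    split_ifs at h
    · obtain ⟨l', hl', rfl⟩ := List.mem_map.1 h
      intro t ht
      rcases List.mem_cons.1 ht with rfl | ht
      exacts [harcs a ha, ih hl' t ht]
    · simp at h

theorem length_walks_le (arcs : List Arc) (s i v : ℕ) :
    (walks arcs s i v).length ≤ arcs.length ^ i := by
  induction i generalizing v with
  | zero => rw [walks]; split_ifs <;> simp
  | succ i ih =>
    rw [walks, List.length_flatMap, pow_succ']
    refine (List.sum_le_card_nsmul _ (arcs.length ^ i) ?_).trans (by simp)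
    intro x hx
    obtain ⟨a, _, rfl⟩ := List.mem_map.1 hx
    split_ifs
    · simpa using ih a.src
    · simp

theorem List.sum_ne_zero_iff_of_nonneg {L : List ℤ} (hL : ∀ x ∈ L, 0 ≤ x) :
    L.sum ≠ 0 ↔ ∃ x ∈ L, x ≠ 0 := by
  constructor
  · intro h
    by_contra! hc
    exact h (List.sum_eq_zero hc)
  · rintro ⟨x, hx, hx0⟩ h
    have := List.single_le_sum hL x hx
    exact hx0 (le_antisymm (h ▸ this) (hL x hx))

theorem walkSum_range_nonneg (arcs : List Arc) (s k v : ℕ) :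
    0 ≤ walkSum arcs s (Finset.range k) (Finset.range k) v := by
  refine List.sum_nonneg fun x hx => ?_
  obtain ⟨l, _, rfl⟩ := List.mem_map.1 hx
  exact mul_self_nonneg _

/-- No cancellation: the top walk sum is a sum of squares of Vandermonde determinants. -/
theorem walkSum_range_ne_zero_iff (arcs : List Arc) (s k v : ℕ) :
    walkSum arcs s (Finset.range k) (Finset.range k) v ≠ 0 ↔
      ∃ l ∈ walks arcs s k v, l.Nodup := by
  rw [walkSum, Finset.card_range, List.sum_ne_zero_iff_of_nonneg]
  · simp only [List.mem_map]
    constructor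
    · rintro ⟨x, ⟨l, hl, rfl⟩, hx⟩
      refine ⟨l, hl, (vandermondeMinor_range_ne_zero_iff l).1 ?_⟩
      rw [length_of_mem_walks hl]
      exact left_ne_zero_of_mul hx
    · rintro ⟨l, hl, hn⟩
      refine ⟨_, ⟨l, hl, rfl⟩, ?_⟩
      have := (vandermondeMinor_range_ne_zero_iff l).2 hn
      rw [length_of_mem_walks hl] at this
      exact mul_ne_zero this this
  · intro x hx
    obtain ⟨l, _, rfl⟩ := List.mem_map.1 hx
    exact mul_self_nonneg _

/-- A crude bound: there are at most `(2 * m) ^ k` walks, and each minor is at most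
`(k * m ^ k) ^ k`. -/
theorem walkSum_range_le {arcs : List Arc} {m : ℕ} (hm : 0 < m)
    (harcs : ∀ a ∈ arcs, a.label ≤ m) (hlen : arcs.length ≤ 2 * m) (s k v : ℕ) :
    walkSum arcs s (Finset.range k) (Finset.range k) v ≤
      ((2 * m * k) ^ (5 * k ^ 2) : ℕ) := by
  rcases Nat.eq_zero_or_pos k with rfl | hk
  · by_cases hv : v = s <;> simp [walkSum, walks, vandermondeMinor, hv]
  have h1 : walkSum arcs s (Finset.range k) (Finset.range k) v ≤
      ((2 * m) ^ k * ((k * m ^ k) ^ k * (k * m ^ k) ^ k) : ℕ) := by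
    rw [walkSum, Finset.card_range]
    refine (List.sum_le_card_nsmul _ (((k * m ^ k) ^ k * (k * m ^ k) ^ k : ℕ) : ℤ) ?_).trans ?_
    · intro x hx
      obtain ⟨l, hl, rfl⟩ := List.mem_map.1 hx
      have := abs_vandermondeMinor_le hm l (le_of_mem_of_mem_walks harcs hl) (Finset.range k)
        subset_rfl
      rw [length_of_mem_walks hl] at this
      calc _ = |vandermondeMinor l (Finset.range k)| * |vandermondeMinor l (Finset.range k)| :=
            (abs_mul_abs_self _).symm
        _ ≤ _ := by
          rw [Nat.cast_mul]
          exact mul_le_mul this this (abs_nonneg _) (by positivity)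
    · rw [List.length_map, nsmul_eq_mul, ← Nat.cast_mul]
      exact_mod_cast Nat.mul_le_mul_right _ ((length_walks_le arcs s k v).trans
        (Nat.pow_le_pow_left hlen k))
  refine h1.trans ?_
  have hY : 0 < 2 * m * k := by positivity
  have e1 : 2 * m ≤ 2 * m * k := Nat.le_mul_of_pos_right _ hk
  have e2 : m ≤ 2 * m * k := by nlinarith
  have e3 : k ≤ 2 * m * k := by nlinarith
  have h2 : (2 * m) ^ k * ((k * m ^ k) ^ k * (k * m ^ k) ^ k) ≤ (2 * m * k) ^ (5 * k ^ 2) :=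
    calc (2 * m) ^ k * ((k * m ^ k) ^ k * (k * m ^ k) ^ k)
        ≤ (2 * m * k) ^ k * (((2 * m * k) * (2 * m * k) ^ k) ^ k *
          ((2 * m * k) * (2 * m * k) ^ k) ^ k) := by gcongr
      _ = (2 * m * k) ^ (3 * k + 2 * k ^ 2) := by ring
      _ ≤ _ := Nat.pow_le_pow_right hY (by nlinarith)
  exact_mod_cast h2

/-! ### Numbers with many consecutive divisors -/

/-- A common multiple of `x, x + 1, …, x + r` is, up to the factor `r!`, a multiple of their
product. This follows from the partial fractions
`r! / (x (x + 1) ⋯ (x + r)) = ∑ i, (-1) ^ i * r.choose i / (x + i)`, in the form of an induction. -/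
theorem Nat.ascFactorial_dvd_mul_factorial {N : ℕ} (r x : ℕ) (h : ∀ i ≤ r, x + i ∣ N) :
    x.ascFactorial (r + 1) ∣ N * r.factorial := by
  induction r generalizing x with
  | zero => simpa [Nat.ascFactorial] using h 0 le_rfl
  | succ r ih =>
    have h1 := ih x fun i hi => h i (by omega)
    have h2 := ih (x + 1) fun i hi => by simpa [add_assoc, add_comm 1] using h (i + 1) (by omega)
    have e1 : x.ascFactorial (r + 1) = x * (x + 1).ascFactorial r := by
      rw [Nat.ascFactorial_succ, Nat.succ_ascFactorial]
    have e2 : x.ascFactorial (r + 2) = x * ((x + 1 + r) * (x + 1).ascFactorial r) := by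
      rw [← Nat.ascFactorial_succ, Nat.succ_ascFactorial, Nat.ascFactorial_succ]
    rw [e1] at h1
    rw [Nat.ascFactorial_succ] at h2
    rw [e2, Nat.factorial_succ]
    obtain ⟨α, hα⟩ := h1
    obtain ⟨β, hβ⟩ := h2
    zify at hα hβ ⊢
    refine ⟨α - β, ?_⟩
    linear_combination ((x : ℤ) + 1 + r) * hα - x * hβ

/-- A number at most `Y ^ r` with `r + 1` consecutive divisors beyond `r * Y` is zero, since
`N * r!` is less than the product of the divisors. -/
theorem Nat.eq_zero_of_forall_add_dvd {N Y r x : ℕ} (hN : N ≤ Y ^ r) (hx : r * Y < x) (hx2 : 1 < x)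
    (h : ∀ i ≤ r, x + i ∣ N) : N = 0 := by
  by_contra hN0
  have h1 := Nat.le_of_dvd (by positivity) (Nat.ascFactorial_dvd_mul_factorial r x h)
  have h2 : x ^ (r + 1) ≤ x.ascFactorial (r + 1) := Nat.pow_succ_le_ascFactorial x (r + 1)
  have h3 : N * r.factorial ≤ x ^ r :=
    calc N * r.factorial ≤ Y ^ r * r ^ r := Nat.mul_le_mul hN (Nat.factorial_le_pow r)
      _ = (r * Y) ^ r := by rw [mul_pow, mul_comm]
      _ ≤ x ^ r := Nat.pow_le_pow_left hx.le r
  have h4 : x ^ r < x ^ (r + 1) := Nat.pow_lt_pow_right hx2 (by omega)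
  omega

/-! ### Circuits as walks with distinct labels -/

/-- Walks in terms of their vertices `p 0, …, p i` and the labels `e 0, …, e (i - 1)` of their arcs;
the values of `p` and `e` beyond these are irrelevant. -/
theorem mem_walks_iff {arcs : List Arc} {s i v : ℕ} {l : List ℕ} :
    l ∈ walks arcs s i v ↔ ∃ p e : ℕ → ℕ, p 0 = s ∧ p i = v ∧
      (∀ j < i, ⟨p j, p (j + 1), e j⟩ ∈ arcs) ∧ l = ((List.range i).map e).reverse := by
  induction i generalizing v l with
  | zero =>
    rw [walks]
    constructor
    · intro h
      split_ifs at h with hv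
      · exact ⟨fun _ => s, fun _ => 0, rfl, hv.symm, by simp, by simpa using h⟩
      · simp at h
    · rintro ⟨p, e, rfl, rfl, -, rfl⟩
      simp
  | succ i ih =>
    simp only [walks, List.mem_flatMap]
    constructor
    · rintro ⟨a, ha, h⟩
      split_ifs at h with hv
      · obtain ⟨l', hl', rfl⟩ := List.mem_map.1 h
        obtain ⟨p, e, h0, hi, hp, rfl⟩ := ih.1 hl'
        refine ⟨Function.update p (i + 1) v, Function.update e i a.label, by simp [h0], by simp,
          ?_, ?_⟩
        · intro j hj
          rcases Nat.lt_succ_iff_lt_or_eq.1 hj with hj | rfl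
          · simpa [Function.update_apply, hj.ne, show j ≠ i + 1 by omega] using hp j hj
          · simpa [Function.update_apply, hi, ← hv] using ha
        · rw [List.range_succ, List.map_append, List.reverse_append]
          simp only [List.map_cons, List.map_nil, Function.update_self, List.reverse_singleton,
            List.singleton_append, List.cons.injEq, true_and]
          congr 1
          refine List.map_congr_left fun j hj => ?_
          rw [Function.update_of_ne (List.mem_range.1 hj).ne]
      · simp at h
    · rintro ⟨p, e, h0, rfl, hp, rfl⟩
      refine ⟨_, hp i (by omega), ?_⟩
      rw [if_pos rfl, List.mem_map]
      refine ⟨_, ih.2 ⟨p, e, h0, rfl, fun j hj => hp j (by omega), rfl⟩, ?_⟩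
      simp [List.range_succ]

theorem exists_nodup_mem_walks_iff {arcs : List Arc} {s k v : ℕ} :
    (∃ l ∈ walks arcs s k v, l.Nodup) ↔ ∃ p e : ℕ → ℕ, p 0 = s ∧ p k = v ∧
      (∀ j < k, ⟨p j, p (j + 1), e j⟩ ∈ arcs) ∧ ∀ i < k, ∀ j < k, e i = e j → i = j := by
  have key : ∀ e : ℕ → ℕ, ((List.range k).map e).reverse.Nodup ↔
      ∀ i < k, ∀ j < k, e i = e j → i = j := by
    intro e
    rw [List.nodup_reverse, List.nodup_map_iff_inj_on List.nodup_range]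
    simp
  constructor
  · rintro ⟨l, hl, hn⟩
    obtain ⟨p, e, h0, hk, hp, rfl⟩ := mem_walks_iff.1 hl
    exact ⟨p, e, h0, hk, hp, (key e).1 hn⟩
  · rintro ⟨p, e, h0, hk, hp, he⟩
    exact ⟨_, mem_walks_iff.2 ⟨p, e, h0, hk, hp, rfl⟩, (key e).2 he⟩

/-- The arcs, labelled by the position in the list, that are given by the list of pairs
`(U i, V i)`, `i < m`; in the undirected case each pair gives two arcs with the same label. -/
def labelledArcs (und : Bool) (U V : ℕ → ℕ) (m : ℕ) : List Arc :=
  (List.range m).flatMap fun i => ⟨U i, V i, i⟩ :: if und then [⟨V i, U i, i⟩] else []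

theorem mem_labelledArcs {und : Bool} {U V : ℕ → ℕ} {m : ℕ} {a : Arc} :
    a ∈ labelledArcs und U V m ↔
      ∃ i < m, a = ⟨U i, V i, i⟩ ∨ und = true ∧ a = ⟨V i, U i, i⟩ := by
  cases und <;> simp [labelledArcs]

theorem length_labelledArcs_le (und : Bool) (U V : ℕ → ℕ) (m : ℕ) :
    (labelledArcs und U V m).length ≤ 2 * m := by
  cases und <;> simp [labelledArcs, mul_comm]
  omega

/-- Since the list has no repetitions, arcs of the graph are distinct if and only if their labels
are. -/
theorem hasDirectedCircuit_iff {n : ℕ} {G : Digraph (Fin n)} {es : List (Fin n × Fin n)}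
    (hes : ListsArcs G es) {U V : ℕ → ℕ} (hU : ∀ i (h : i < es.length), U i = es[i].1)
    (hV : ∀ i (h : i < es.length), V i = es[i].2) (k : ℕ) :
    HasDirectedCircuit G k ↔
      ∃ s < n, ∃ l ∈ walks (labelledArcs false U V es.length) s k s, l.Nodup := by
  simp only [exists_nodup_mem_walks_iff, mem_labelledArcs]
  constructor
  · rintro ⟨v, hadj, hinj, hcl⟩
    have hex : ∀ i : Fin k, ∃ j, ∃ h : j < es.length, es[j] = (v i.castSucc, v i.succ) :=
      fun i => List.getElem_of_mem ((hes.2 _).2 (hadj i))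
    choose e he hee using hex
    refine ⟨v 0, (v 0).2, fun j => if h : j < k + 1 then v ⟨j, h⟩ else 0,
      fun j => if h : j < k then e ⟨j, h⟩ else 0, by simp, ?_, ?_, ?_⟩
    · simp only [lt_add_iff_pos_right, zero_lt_one, dite_true]
      rw [hcl]
      rfl
    · intro j hj
      refine ⟨e ⟨j, hj⟩, he _, Or.inl ?_⟩
      rw [hU _ (he _), hV _ (he _), hee]
      simp [hj, Nat.lt_succ_of_lt hj]
    · intro i hi j hj hij
      simp only [hi, hj, dite_true] at hij
      have := hinj (a₁ := ⟨i, hi⟩) (a₂ := ⟨j, hj⟩) (by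
        simp only [← hee, hij])
      simpa using this
  · rintro ⟨s, hs, p, e, h0, hk, hp, he⟩
    have hp' : ∀ j < k, ∃ h : e j < es.length, p j = es[e j].1 ∧ p (j + 1) = es[e j].2 := by
      intro j hj
      obtain ⟨i, hi, h⟩ := hp j hj
      simp only [Arc.mk.injEq, Bool.false_eq_true, false_and, or_false] at h
      obtain ⟨h1, h2, rfl⟩ := h
      exact ⟨hi, by rw [h1, hU _ hi], by rw [h2, hV _ hi]⟩
    have hlt : ∀ j ≤ k, p j < n := by
      intro j hj
      rcases hj.lt_or_eq with hj | rfl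
      · obtain ⟨h, h1, -⟩ := hp' j hj
        rw [h1]
        exact Fin.is_lt _
      · rwa [hk]
    have hpair : ∀ i : Fin k, ∃ h : e i < es.length, es[e i] =
        ((⟨p i, hlt _ i.2.le⟩ : Fin n), (⟨p (i + 1), hlt _ i.2⟩ : Fin n)) := by
      intro i
      obtain ⟨h, h1, h2⟩ := hp' i i.2
      exact ⟨h, Prod.ext (Fin.ext h1.symm) (Fin.ext h2.symm)⟩
    refine ⟨fun i => ⟨p i, hlt i (Nat.lt_succ_iff.1 i.2)⟩, ?_, ?_, ?_⟩
    · intro i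
      obtain ⟨h, h1⟩ := hpair i
      have := (hes.2 _).1 (List.getElem_mem h)
      rw [h1] at this
      exact this
    · intro i j hij
      obtain ⟨hi, hi'⟩ := hpair i
      obtain ⟨hj, hj'⟩ := hpair j
      have : es[e i] = es[e j] := by
        rw [hi', hj']
        exact hij
      exact Fin.ext (he _ i.2 _ j.2 ((hes.1.getElem_inj_iff).1 this))
    · simp [h0, hk]

/-- Both orientations of an edge carry its label, so that distinct labels mean distinct undirected
edges. -/
theorem hasCircuit_iff {n : ℕ} {G : SimpleGraph (Fin n)} {es : List (Fin n × Fin n)}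
    (hes : ListsEdges G es) {U V : ℕ → ℕ} (hU : ∀ i (h : i < es.length), U i = es[i].1)
    (hV : ∀ i (h : i < es.length), V i = es[i].2) (k : ℕ) :
    HasCircuit G k ↔
      ∃ s < n, ∃ l ∈ walks (labelledArcs true U V es.length) s k s, l.Nodup := by
  have hinj : ∀ i j (hi : i < es.length) (hj : j < es.length),
      s(es[i].1, es[i].2) = s(es[j].1, es[j].2) → i = j := by
    intro i j hi hj h
    have h1 := (hes.1.getElem_inj_iff (i := i) (j := j) (hi := by simpa) (hj := by simpa)).1
    exact h1 (by simpa using h)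
  have hedge : ∀ i (hi : i < es.length), s(es[i].1, es[i].2) ∈ G.edgeSet := fun i hi =>
    (hes.2 _).1 (List.mem_map.2 ⟨es[i], List.getElem_mem hi, rfl⟩)
  simp only [exists_nodup_mem_walks_iff, mem_labelledArcs, true_and]
  constructor
  · rintro ⟨u, c, htr, hlen⟩
    have hex : ∀ j < k, ∃ i, ∃ h : i < es.length,
        s(es[i].1, es[i].2) = s(c.getVert j, c.getVert (j + 1)) := by
      intro j hj
      have hadj := c.adj_getVert_succ (i := j) (by omega)
      obtain ⟨e, he, hee⟩ := List.mem_map.1 ((hes.2 _).2 (G.mem_edgeSet.2 hadj))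
      obtain ⟨i, hi, rfl⟩ := List.getElem_of_mem he
      exact ⟨i, hi, hee⟩
    choose! e he hee using hex
    refine ⟨u, u.2, fun j => c.getVert j, e, by simp, by simp [← hlen], ?_, ?_⟩
    · intro j hj
      refine ⟨e j, he j hj, ?_⟩
      rw [hU _ (he j hj), hV _ (he j hj)]
      rcases Sym2.eq_iff.1 (hee j hj) with ⟨h1, h2⟩ | ⟨h1, h2⟩
      · exact Or.inl (by rw [h1, h2])
      · exact Or.inr (by rw [h1, h2])
    · intro i hi j hj hij
      have h1 := hee i hi
      simp only [hij] at h1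
      rw [hee j hj] at h1
      have hl : c.edges.length = k := by simp [hlen]
      have hget : ∀ i (hi : i < c.edges.length),
          c.edges[i] = s(c.getVert i, c.getVert (i + 1)) := by
        intro i hi
        rw [c.getElem_edges_eq_edge_getElem_darts, SimpleGraph.Dart.edge,
          SimpleGraph.Walk.darts_getElem_eq_getVert]
      refine (htr.edges_nodup.getElem_inj_iff (hi := by omega) (hj := by omega)).1 ?_
      rw [hget i (by omega), hget j (by omega), h1]
  · rintro ⟨s, hs, p, e, h0, hk, hp, he⟩
    have hp' : ∀ j < k, ∃ h : e j < es.length, ∃ (h1 : p j < n) (h2 : p (j + 1) < n),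
        s(es[e j].1, es[e j].2) = s(⟨p j, h1⟩, ⟨p (j + 1), h2⟩) := by
      intro j hj
      obtain ⟨i, hi, h⟩ := hp j hj
      simp only [Arc.mk.injEq] at h
      rw [hU i hi, hV i hi] at h
      rcases h with ⟨h1, h2, rfl⟩ | ⟨h1, h2, rfl⟩
      · refine ⟨hi, by rw [h1]; exact Fin.is_lt _, by rw [h2]; exact Fin.is_lt _, ?_⟩
        simp [h1, h2]
      · refine ⟨hi, by rw [h1]; exact Fin.is_lt _, by rw [h2]; exact Fin.is_lt _, ?_⟩
        rw [Sym2.eq_swap]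
        simp [h1, h2]
    have hlt : ∀ j ≤ k, p j < n := by
      intro j hj
      rcases hj.lt_or_eq with hj | rfl
      · exact (hp' j hj).2.1
      · rwa [hk]
    -- the prefixes of the vertex sequence as walks, with their edges in terms of the labels
    have hwalk : ∀ i (hi : i ≤ k), ∃ q : G.Walk ⟨p 0, hlt 0 (Nat.zero_le k)⟩ ⟨p i, hlt i hi⟩,
        q.length = i ∧ q.edges = (List.range i).map fun j =>
          if h : e j < es.length then s(es[e j].1, es[e j].2) else s(⟨s, hs⟩, ⟨s, hs⟩) := by
      intro i
      induction i with
      | zero => exact fun _ => ⟨.nil, rfl, rfl⟩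
      | succ i ih =>
        intro hi
        obtain ⟨q, hq1, hq2⟩ := ih (by omega)
        obtain ⟨h, h1, h2, h3⟩ := hp' i hi
        have hadj : G.Adj ⟨p i, h1⟩ ⟨p (i + 1), h2⟩ := by
          rw [← G.mem_edgeSet, ← h3]
          exact hedge _ h
        refine ⟨q.concat hadj, by simp [hq1], ?_⟩
        rw [SimpleGraph.Walk.edges_concat, hq2, List.range_succ]
        simp [h, h3]
    obtain ⟨q, hq1, hq2⟩ := hwalk k le_rfl
    have hq3 : q.IsTrail := by
      refine ⟨?_⟩
      rw [hq2, List.nodup_map_iff_inj_on List.nodup_range]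
      intro i hi j hj hij
      rw [List.mem_range] at hi hj
      obtain ⟨hi', -⟩ := hp' i hi
      obtain ⟨hj', -⟩ := hp' j hj
      simp only [hi', hj', dite_true] at hij
      exact he i hi j hj (hinj _ _ hi' hj' hij)
    have hpk : (⟨p k, hlt k le_rfl⟩ : Fin n) = ⟨p 0, hlt 0 (Nat.zero_le k)⟩ :=
      Fin.ext (hk.trans h0.symm)
    exact ⟨_, q.copy rfl hpk, by simpa using hq3, by simpa using hq1⟩

/-! ### Masks for pairs of column sets -/

theorem rowCoeff_zero (t : ℕ) (A : Finset ℕ) : rowCoeff t A 0 = 1 := by simp [rowCoeff]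

/-- The rule by which the program updates the coefficient from one column to the next: multiply by
`-t` if the column belongs to `A`, and by `t` otherwise. -/
theorem rowCoeff_succ (t : ℕ) (A : Finset ℕ) (a : ℕ) :
    rowCoeff t A (a + 1) = rowCoeff t A a * if a ∈ A then -(t : ℤ) else t := by
  have h : Finset.filter (· < a + 1) A =
      if a ∈ A then insert a (Finset.filter (· < a) A) else Finset.filter (· < a) A := by
    ext b
    split_ifs with ha <;> simp only [Finset.mem_filter, Finset.mem_insert] <;> grind
  unfold rowCoeff
  rw [h]
  split_ifs with ha
  · rw [Finset.card_insert_of_notMem (by simp)]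
    ring
  · ring

/-- The set of columns given by the lower `k` bits of the mask `M`. -/
def lowBits (k M : ℕ) : Finset ℕ := {a ∈ Finset.range k | M.testBit a}

/-- The set of columns given by the bits `k, …, 2 * k - 1` of the mask `M`. -/
def highBits (k M : ℕ) : Finset ℕ := {a ∈ Finset.range k | M.testBit (k + a)}

theorem mem_lowBits {k M a : ℕ} : a ∈ lowBits k M ↔ a < k ∧ M.testBit a = true := by
  simp [lowBits]

theorem mem_highBits {k M a : ℕ} : a ∈ highBits k M ↔ a < k ∧ M.testBit (k + a) = true := by
  simp [highBits]

/-- Removing a column from both sets makes the mask smaller, so that the recurrence only refers to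
cells that have been computed when the masks are treated in increasing order. -/
theorem Nat.xor_two_pow_xor_two_pow_lt {k M x y : ℕ} (hx : x ∈ lowBits k M)
    (hy : y ∈ highBits k M) : M ^^^ 2 ^ x ^^^ 2 ^ (k + y) < M := by
  rw [mem_lowBits] at hx
  rw [mem_highBits] at hy
  refine Nat.lt_of_testBit (k + y) ?_ hy.2 fun j hj => ?_
  · simp [Nat.testBit_xor, Nat.testBit_two_pow, hy.2]
    omega
  · have h1 : ¬ k + y = j := by omega
    have h2 : ¬ x = j := by omega
    simp [Nat.testBit_xor, h1, h2]

theorem lowBits_xor {k M x y : ℕ} (hx : x ∈ lowBits k M) :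
    lowBits k (M ^^^ 2 ^ x ^^^ 2 ^ (k + y)) = (lowBits k M).erase x := by
  ext a
  rw [Finset.mem_erase, mem_lowBits, mem_lowBits]
  rw [mem_lowBits] at hx
  by_cases ha : a < k
  · have h1 : ¬ k + y = a := by omega
    by_cases h2 : x = a
    · simp [Nat.testBit_xor, h1, h2, ha]
      subst h2; simp [hx.2]
    · simp [Nat.testBit_xor, h1, h2, ha, Ne.symm h2]
  · simp [ha]

theorem highBits_xor {k M x y : ℕ} (hx : x ∈ lowBits k M) (hy : y ∈ highBits k M) :
    highBits k (M ^^^ 2 ^ x ^^^ 2 ^ (k + y)) = (highBits k M).erase y := by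
  ext a
  rw [Finset.mem_erase, mem_highBits, mem_highBits]
  rw [mem_lowBits] at hx
  rw [mem_highBits] at hy
  have h1 : ¬ x = k + a := by omega
  by_cases h2 : y = a
  · subst h2
    simp [Nat.testBit_xor, h1, hy.2]
  · simp [Nat.testBit_xor, h1, h2, Ne.symm h2]

theorem eq_zero_of_lowBits_of_highBits {k M : ℕ} (hM : M < 2 ^ (2 * k)) (h1 : lowBits k M = ∅)
    (h2 : highBits k M = ∅) : M = 0 := by
  refine Nat.eq_of_testBit_eq fun i => ?_
  rw [Nat.zero_testBit]
  by_contra h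
  rw [Bool.not_eq_false] at h
  rcases lt_or_ge i k with hi | hi
  · exact Finset.notMem_empty i (h1 ▸ mem_lowBits.2 ⟨hi, h⟩)
  · rcases lt_or_ge i (2 * k) with hi2 | hi2
    · exact Finset.notMem_empty (i - k) (h2 ▸ mem_highBits.2
        ⟨by omega, by rwa [show k + (i - k) = i by omega]⟩)
    · rw [Nat.testBit_lt_two_pow (hM.trans_le (Nat.pow_le_pow_right (by norm_num) hi2))] at h
      simp at h

theorem lowBits_zero (k : ℕ) : lowBits k 0 = ∅ := by simp [lowBits]

theorem highBits_zero (k : ℕ) : highBits k 0 = ∅ := by simp [highBits]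

theorem lowBits_top (k : ℕ) : lowBits k (2 ^ (2 * k) - 1) = Finset.range k := by
  ext a
  simp only [mem_lowBits, Finset.mem_range, Nat.testBit_two_pow_sub_one, decide_eq_true_eq]
  omega

theorem highBits_top (k : ℕ) : highBits k (2 ^ (2 * k) - 1) = Finset.range k := by
  ext a
  simp only [mem_highBits, Finset.mem_range, Nat.testBit_two_pow_sub_one, decide_eq_true_eq]
  omega

theorem Nat.shiftRight_and_one (M i : ℕ) : M >>> i &&& 1 = if M.testBit i then 1 else 0 := by
  rw [Nat.and_one_is_mod, Nat.testBit_eq_decide_div_mod_eq, Nat.shiftRight_eq_div_pow]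
  split_ifs with h <;> simp at h <;> omega

theorem Nat.add_mul_lt_mul_self {q x y z : ℕ} (hx : x < q) (hy : y < q) (hz : z < q) :
    z + x * y < q * q := by
  obtain ⟨q, rfl⟩ : ∃ q', q = q' + 1 := ⟨q - 1, by omega⟩
  have := Nat.mul_le_mul (Nat.lt_succ_iff.1 hx) (Nat.lt_succ_iff.1 hy)
  nlinarith

theorem Nat.mul_lt_mul_self {q x y : ℕ} (hx : x < q) (hy : y ≤ q) : x * y < q * q :=
  (Nat.mul_le_mul_left x hy).trans_lt (Nat.mul_lt_mul_of_pos_right hx (by omega))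

namespace WordRAM

/-- Sequential composition of a list of commands. -/
def Cmd.block (l : List Cmd) : Cmd := l.foldr Cmd.seq Cmd.skip

theorem Cmd.eval_block_nil (w : ℕ) (s : State) : (Cmd.block []).eval w s = s := rfl

theorem Cmd.eval_block_cons (w : ℕ) (c : Cmd) (l : List Cmd) (s : State) :
    (Cmd.block (c :: l)).eval w s = (Cmd.block l).eval w (c.eval w s) := rfl

/-! ### The program

Numbers are stored modulo the current modulus in cells behind the input, one cell for each pair of a
vertex `v` and a mask `M < 4 ^ k`, at the address `3 + 2 * m + v * 4 ^ k + M`.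

* `rOne`, …, `rX` hold values that are fixed by the input: the constants `1` and `0`, `m`, `k`, the
  number of start vertices, `4 ^ k`, the number of moduli, the address `3 + 2 * m` of the first
  cell and the first modulus.
* `rAns` is the answer, which starts as `0` and becomes `1` once a witness has been found.
* `rS`, `rJ`, `rMask`, `rE`, `rCol` and `rCol2` count the start vertices, the moduli, the masks, the
  edges and the columns of the two minors.
* `rQ` is the current modulus `q`, `rNeg` is `q - t` for the label `t` in `rE`, which stands
  for `-t`, and `rU` and `rV` are the ends of the current edge.
* `rCoef` and `rCoef2` are the coefficient of the column in the first minor, and the product of the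
  coefficients in both minors.
* `rSrc` is the address of the cell of the source for the mask `0`, `rDst` the address of the cell
  that is being computed, `rAcc` its value so far, and `rSub` the current mask without the column of
  the first minor.

Adding the register `rZero` serves as a copy instruction. -/

local notation "rOne" => (0 : ℕ)
local notation "rZero" => (1 : ℕ)
local notation "rEdges" => (2 : ℕ)
local notation "rK" => (3 : ℕ)
local notation "rVerts" => (4 : ℕ)
local notation "rMasks" => (5 : ℕ)
local notation "rModuli" => (6 : ℕ)
local notation "rBase" => (7 : ℕ)
local notation "rX" => (8 : ℕ)
local notation "rAns" => (9 : ℕ)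
local notation "rS" => (10 : ℕ)
local notation "rJ" => (11 : ℕ)
local notation "rMask" => (12 : ℕ)
local notation "rE" => (13 : ℕ)
local notation "rCol" => (14 : ℕ)
local notation "rCol2" => (15 : ℕ)
local notation "rQ" => (16 : ℕ)
local notation "rU" => (17 : ℕ)
local notation "rV" => (18 : ℕ)
local notation "rNeg" => (19 : ℕ)
local notation "rCoef" => (20 : ℕ)
local notation "rCoef2" => (21 : ℕ)
local notation "rAcc" => (22 : ℕ)
local notation "rTmp" => (23 : ℕ)
local notation "rTmp2" => (24 : ℕ)
local notation "rSrc" => (25 : ℕ)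
local notation "rDst" => (26 : ℕ)
local notation "rSub" => (27 : ℕ)

open Cmd

/-- Round of the loop over the columns of the second minor. -/
def highStep : Cmd := block [
  op .add rTmp rK rCol2,
  op .shr rTmp2 rMask rTmp,
  op .and rTmp2 rTmp2 rOne,
  ite rTmp2 rOne
    (block [
      op .shl rTmp2 rOne rTmp,
      op .xor rTmp2 rSub rTmp2,
      op .add rTmp2 rSrc rTmp2,
      load rTmp2 rTmp2,
      op .mul rTmp2 rCoef2 rTmp2,
      op .add rAcc rAcc rTmp2,
      op .mod rAcc rAcc rQ,
      op .mul rCoef2 rCoef2 rNeg,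
      op .mod rCoef2 rCoef2 rQ])
    (block [
      op .mul rCoef2 rCoef2 rE,
      op .mod rCoef2 rCoef2 rQ])]

/-- Round of the loop over the columns of the first minor. -/
def lowStep : Cmd := block [
  op .shr rTmp rMask rCol,
  op .and rTmp rTmp rOne,
  ite rTmp rOne
    (block [
      op .shl rTmp rOne rCol,
      op .xor rSub rMask rTmp,
      op .add rCoef2 rCoef rZero,
      loop rCol2 rK highStep,
      op .mul rCoef rCoef rNeg,
      op .mod rCoef rCoef rQ])
    (block [
      op .mul rCoef rCoef rE,
      op .mod rCoef rCoef rQ])]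

/-- Add the contribution of the arc from register `u` to register `v` with label `rE` to the cell
of `v` for the current mask. -/
def arcStep (u v : ℕ) : Cmd := block [
  op .mul rTmp u rMasks,
  op .add rSrc rBase rTmp,
  op .mul rTmp v rMasks,
  op .add rTmp rTmp rBase,
  op .add rDst rTmp rMask,
  load rAcc rDst,
  op .add rCoef rOne rZero,
  loop rCol rK lowStep,
  store rDst rAcc]

/-! ### Correctness of the program -/

/-- For a fixed column of the first minor, the loop adds the terms for all columns of the second
minor to the accumulator. -/
theorem highLoop_spec {w k M q t T : ℕ} (s : State) (h0 : s.reg rOne = 1) (hk : s.reg rK = k)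
    (hM : s.reg rMask = M) (hE : s.reg rE = t) (hq : s.reg rQ = q) (hNeg : s.reg rNeg = q - t)
    (hT : s.reg rSub = T) (hCoef : s.reg rCoef2 < q) (hAcc : s.reg rAcc < q)
    (ht : t < q) (hqw : q * q ≤ 2 ^ w) (hkw : 2 * k < w) (hMk : M < 2 ^ (2 * k))
    (hTk : T < 2 ^ (2 * k)) (hSrc : ∀ N < 2 ^ (2 * k), s.reg rSrc + N < 2 ^ w)
    (hcell : ∀ y ∈ highBits k M, s.mem (s.reg rSrc + (T ^^^ 2 ^ (k + y))) < q) :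
    ((loop rCol2 rK highStep).eval w s).reg rAcc < q ∧
      ((((loop rCol2 rK highStep).eval w s).reg rAcc : ℕ) : ZMod q) = s.reg rAcc +
        ∑ y ∈ highBits k M, s.reg rCoef2 * ((rowCoeff t (highBits k M) y : ℤ) : ZMod q) *
          (s.mem (s.reg rSrc + (T ^^^ 2 ^ (k + y))) : ZMod q) := by
  have hq0 : 0 < q := by omega
  have hMw : M < 2 ^ w := hMk.trans_le (Nat.pow_le_pow_right (by norm_num) hkw.le)
  have hqlt : q ≤ 2 ^ w := (Nat.le_mul_self q).trans hqw
  have hw2 : w < 2 ^ w := Nat.lt_two_pow_self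
  have key := loop_induction (w := w) (i := rCol2) (n := rK) (c := highStep) (s := s)
    (fun j s' => s'.reg rAcc < q ∧ s'.reg rCoef2 < q ∧
      ((s'.reg rCoef2 : ℕ) : ZMod q) = s.reg rCoef2 * ((rowCoeff t (highBits k M) j : ℤ) : ZMod q) ∧
      s'.mem = s.mem ∧
      ((s'.reg rAcc : ℕ) : ZMod q) = s.reg rAcc +
        ∑ y ∈ Finset.range j, if M.testBit (k + y) then
          s.reg rCoef2 * ((rowCoeff t (highBits k M) y : ℤ) : ZMod q) *
          (s.mem (s.reg rSrc + (T ^^^ 2 ^ (k + y))) : ZMod q) else 0) ?_ ?_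
  · obtain ⟨h1, -, -, -, h5⟩ := key
    refine ⟨h1, ?_⟩
    rw [h5, hk, highBits, Finset.sum_filter]
  · simp [State.set_reg, hCoef, hAcc, rowCoeff_zero]
  · rintro j hj s' hr hrB ⟨i1, i2, i3, i4, i5⟩
    rw [hk] at hj
    have r0 : s'.reg rOne = 1 := (hr _ (by decide)).trans h0
    have r1 : s'.reg rK = k := (hr _ (by decide)).trans hk
    have r2 : s'.reg rMask = M := (hr _ (by decide)).trans hM
    have r3 : s'.reg rE = t := (hr _ (by decide)).trans hE
    have r4 : s'.reg rQ = q := (hr _ (by decide)).trans hq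
    have r5 : s'.reg rNeg = q - t := (hr _ (by decide)).trans hNeg
    have r6 : s'.reg rSub = T := (hr _ (by decide)).trans hT
    have r7 : s'.reg rSrc = s.reg rSrc := hr _ (by decide)
    have e1 : (k + j) % 2 ^ w = k + j := Nat.mod_eq_of_lt (by omega)
    have e2 : M >>> (k + j) % 2 ^ w = M >>> (k + j) :=
      Nat.mod_eq_of_lt ((Nat.shiftRight_le M _).trans_lt hMw)
    have e3 : 1 % 2 ^ w = 1 := Nat.mod_eq_of_lt (by omega)
    by_cases hb : M.testBit (k + j) = true
    · have hmem : j ∈ highBits k M := mem_highBits.2 ⟨hj, hb⟩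
      have hcj := hcell j hmem
      have hpow : 2 ^ (k + j) < 2 ^ (2 * k) := Nat.pow_lt_pow_right (by norm_num) (by omega)
      have hKw : 2 ^ (2 * k) ≤ 2 ^ w := Nat.pow_le_pow_right (by norm_num) hkw.le
      have hx : T ^^^ 2 ^ (k + j) < 2 ^ (2 * k) := Nat.xor_lt_two_pow hTk hpow
      have e4 : 1 <<< (k + j) % 2 ^ w = 2 ^ (k + j) := by
        rw [Nat.one_shiftLeft, Nat.mod_eq_of_lt (hpow.trans_le hKw)]
      have e5 : (T ^^^ 2 ^ (k + j)) % 2 ^ w = T ^^^ 2 ^ (k + j) :=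
        Nat.mod_eq_of_lt (hx.trans_le hKw)
      have e6 := Nat.mod_eq_of_lt (hSrc _ hx)
      have e7 := Nat.mod_eq_of_lt ((Nat.mul_lt_mul_self i2 hcj.le).trans_le hqw)
      have e8 := Nat.mod_eq_of_lt ((Nat.add_mul_lt_mul_self i2 hcj i1).trans_le hqw)
      have e9 := Nat.mod_eq_of_lt ((Nat.mul_lt_mul_self i2 (Nat.sub_le q t)).trans_le hqw)
      have e10 := fun x => Nat.mod_eq_of_lt ((Nat.mod_lt x hq0).trans_le hqlt)
      simp only [highStep, eval_block_cons, eval_block_nil, eval_op, eval_ite, eval_load, Op.eval,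
        State.set_reg, State.set_mem, r0, r1, r2, r4, r5, r6, r7, hrB, e1, e2, e3, e4, e5, e6, e7,
        e8, e9, e10, i4, Nat.shiftRight_and_one, hb, if_true, if_false, Nat.reduceEqDiff,
        OfNat.zero_ne_ofNat]
      refine ⟨Nat.mod_lt _ hq0, Nat.mod_lt _ hq0, ?_, ?_⟩
      · rw [ZMod.natCast_mod, rowCoeff_succ, if_pos hmem, Nat.cast_mul, i3, Nat.cast_sub ht.le,
          ZMod.natCast_self]
        push_cast
        ring
      · rw [ZMod.natCast_mod, Nat.cast_add, Nat.cast_mul, i3, i5, Finset.sum_range_succ, if_pos hb,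
          add_assoc]
        exact ⟨trivial, rfl⟩
    · have hmem : j ∉ highBits k M := fun h => hb (mem_highBits.1 h).2
      have e9 := Nat.mod_eq_of_lt ((Nat.mul_lt_mul_self i2 ht.le).trans_le hqw)
      have e10 := fun x => Nat.mod_eq_of_lt ((Nat.mod_lt x hq0).trans_le hqlt)
      simp only [highStep, eval_block_cons, eval_block_nil, eval_op, eval_ite, Op.eval,
        State.set_reg, State.set_mem, r0, r1, r2, r3, r4, hrB, e1, e2, e9, e10, i4,
        Nat.shiftRight_and_one, hb, Bool.false_eq_true, if_true, if_false, Nat.reduceEqDiff,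
        OfNat.zero_ne_ofNat, Nat.zero_mod, zero_ne_one]
      refine ⟨i1, Nat.mod_lt _ hq0, ?_, trivial, ?_⟩
      · rw [ZMod.natCast_mod, rowCoeff_succ, if_neg hmem, Nat.cast_mul, i3]
        push_cast
        ring
      · rw [i5, Finset.sum_range_succ, if_neg (by simpa using hb), add_zero]

/-- The loop adds the double sum of the recurrence `walkSum_eq` for a single arc to the accumulator.
-/
theorem lowLoop_spec {w k M q t : ℕ} (s : State) (h0 : s.reg rOne = 1) (hz : s.reg rZero = 0)
    (hk : s.reg rK = k) (hM : s.reg rMask = M) (hE : s.reg rE = t) (hq : s.reg rQ = q)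
    (hNeg : s.reg rNeg = q - t) (hCoef : s.reg rCoef = 1) (hAcc : s.reg rAcc < q)
    (ht : t < q) (hq2 : 2 ≤ q) (hqw : q * q ≤ 2 ^ w) (hkw : 2 * k < w) (hMk : M < 2 ^ (2 * k))
    (hSrc : ∀ N < 2 ^ (2 * k), s.reg rSrc + N < 2 ^ w)
    (hcell : ∀ x ∈ lowBits k M, ∀ y ∈ highBits k M,
      s.mem (s.reg rSrc + (M ^^^ 2 ^ x ^^^ 2 ^ (k + y))) < q) :
    ((loop rCol rK lowStep).eval w s).reg rAcc < q ∧
      ((((loop rCol rK lowStep).eval w s).reg rAcc : ℕ) : ZMod q) = s.reg rAcc +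
        ∑ x ∈ lowBits k M, ∑ y ∈ highBits k M,
          ((rowCoeff t (lowBits k M) x : ℤ) : ZMod q) *
          ((rowCoeff t (highBits k M) y : ℤ) : ZMod q) *
          (s.mem (s.reg rSrc + (M ^^^ 2 ^ x ^^^ 2 ^ (k + y))) : ZMod q) := by
  have hq0 : 0 < q := by omega
  have hMw : M < 2 ^ w := hMk.trans_le (Nat.pow_le_pow_right (by norm_num) hkw.le)
  have hqlt : q ≤ 2 ^ w := (Nat.le_mul_self q).trans hqw
  have hw2 : w < 2 ^ w := Nat.lt_two_pow_self
  have key := loop_induction (w := w) (i := rCol) (n := rK) (c := lowStep) (s := s)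
    (fun j s' => s'.reg rAcc < q ∧ s'.reg rCoef < q ∧
      ((s'.reg rCoef : ℕ) : ZMod q) = ((rowCoeff t (lowBits k M) j : ℤ) : ZMod q) ∧
      s'.mem = s.mem ∧
      ((s'.reg rAcc : ℕ) : ZMod q) = s.reg rAcc +
        ∑ x ∈ Finset.range j, if M.testBit x then
          ∑ y ∈ highBits k M, ((rowCoeff t (lowBits k M) x : ℤ) : ZMod q) *
          ((rowCoeff t (highBits k M) y : ℤ) : ZMod q) *
          (s.mem (s.reg rSrc + (M ^^^ 2 ^ x ^^^ 2 ^ (k + y))) : ZMod q) else 0) ?_ ?_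
  · obtain ⟨h1, -, -, -, h5⟩ := key
    refine ⟨h1, ?_⟩
    rw [h5, hk, lowBits, Finset.sum_filter]
  · simp only [State.set_reg, State.set_mem, hCoef, rowCoeff_zero, Nat.reduceEqDiff, if_false]
    simp only [Finset.range_zero, Finset.sum_empty]
    exact ⟨hAcc, by omega, by simp, trivial, by simp⟩
  · rintro j hj s' hr hrB ⟨i1, i2, i3, i4, i5⟩
    rw [hk] at hj
    have r0 : s'.reg rOne = 1 := (hr _ (by decide)).trans h0
    have r1 : s'.reg rK = k := (hr _ (by decide)).trans hk
    have r2 : s'.reg rMask = M := (hr _ (by decide)).trans hM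
    have r3 : s'.reg rE = t := (hr _ (by decide)).trans hE
    have r4 : s'.reg rQ = q := (hr _ (by decide)).trans hq
    have r5 : s'.reg rNeg = q - t := (hr _ (by decide)).trans hNeg
    have r6 : s'.reg rZero = 0 := (hr _ (by decide)).trans hz
    have r7 : s'.reg rSrc = s.reg rSrc := hr _ (by decide)
    have e2 : M >>> j % 2 ^ w = M >>> j :=
      Nat.mod_eq_of_lt ((Nat.shiftRight_le M _).trans_lt hMw)
    have e3 : 1 % 2 ^ w = 1 := Nat.mod_eq_of_lt (by omega)
    have e10 := fun x => Nat.mod_eq_of_lt ((Nat.mod_lt x hq0).trans_le hqlt)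
    by_cases hb : M.testBit j = true
    · have hmem : j ∈ lowBits k M := mem_lowBits.2 ⟨hj, hb⟩
      have hpow : 2 ^ j < 2 ^ (2 * k) := Nat.pow_lt_pow_right (by norm_num) (by omega)
      have hKw : 2 ^ (2 * k) ≤ 2 ^ w := Nat.pow_le_pow_right (by norm_num) hkw.le
      have hx : M ^^^ 2 ^ j < 2 ^ (2 * k) := Nat.xor_lt_two_pow hMk hpow
      have e4 : 1 <<< j % 2 ^ w = 2 ^ j := by
        rw [Nat.one_shiftLeft, Nat.mod_eq_of_lt (hpow.trans_le hKw)]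
      have e5 : (M ^^^ 2 ^ j) % 2 ^ w = M ^^^ 2 ^ j := Nat.mod_eq_of_lt (hx.trans_le hKw)
      have e6 : (s'.reg rCoef + 0) % 2 ^ w = s'.reg rCoef := Nat.mod_eq_of_lt (by omega)
      have e9 := Nat.mod_eq_of_lt ((Nat.mul_lt_mul_self i2 (Nat.sub_le q t)).trans_le hqw)
      simp only [lowStep, eval_block_cons, eval_block_nil, eval_op, eval_ite, Op.eval,
        State.set_reg, State.set_mem, r0, r2, r6, hrB, e2, e3, e4, e5, e6, Nat.shiftRight_and_one,
        hb, if_true, if_false, Nat.reduceEqDiff, OfNat.zero_ne_ofNat, OfNat.one_ne_ofNat]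
      -- the state before the loop over the columns of the second minor
      generalize hs₁ : (((((s'.set rTmp (M >>> j)).set rTmp 1).set rTmp (2 ^ j)).set
        rSub (M ^^^ 2 ^ j)).set rCoef2 (s'.reg rCoef)) = s₁
      have hmem₁ : s₁.mem = s.mem := by rw [← hs₁]; exact i4
      have hreg₁ : ∀ r, r ≠ rTmp → r ≠ rSub → r ≠ rCoef2 → s₁.reg r = s'.reg r := by
        intro r h1 h2 h3
        simp [← hs₁, State.set_reg, h1, h2, h3]
      have hsub₁ : s₁.reg rSub = M ^^^ 2 ^ j := by simp [← hs₁, State.set_reg]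
      have hcoef₁ : s₁.reg rCoef2 = s'.reg rCoef := by simp [← hs₁, State.set_reg]
      have hsrc₁ : s₁.reg rSrc = s.reg rSrc := by simp [hreg₁, r7]
      obtain ⟨l1, l2⟩ := highLoop_spec (w := w) (k := k) (M := M) (q := q) (t := t) s₁
        (by simp [hreg₁, r0]) (by simp [hreg₁, r1]) (by simp [hreg₁, r2]) (by simp [hreg₁, r3])
        (by simp [hreg₁, r4]) (by simp [hreg₁, r5]) hsub₁ (by simp [hcoef₁, i2])
        (by simp [hreg₁, i1]) ht hqw hkw hMk hx (by rwa [hsrc₁])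
        (by rw [hsrc₁, hmem₁]; exact hcell j hmem)
      have hframe : ∀ r ∉ (loop rCol2 rK highStep).writes,
          ((loop rCol2 rK highStep).eval w s₁).reg r = s₁.reg r :=
        fun r hr => eval_reg_of_notMem_writes w _ hr s₁
      have f1 : ((loop rCol2 rK highStep).eval w s₁).reg rCoef = s'.reg rCoef :=
        (hframe rCoef (by decide)).trans (by simp [hreg₁])
      have f2 : ((loop rCol2 rK highStep).eval w s₁).reg rNeg = q - t :=
        (hframe rNeg (by decide)).trans (by simp [hreg₁, r5])
      have f3 : ((loop rCol2 rK highStep).eval w s₁).reg rQ = q :=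
        (hframe rQ (by decide)).trans (by simp [hreg₁, r4])
      have f4 : ((loop rCol2 rK highStep).eval w s₁).mem = s.mem :=
        (eval_mem_of_storeless w (loop rCol2 rK highStep)
          (by simp [Storeless, highStep, block]) s₁).trans hmem₁
      rw [hsrc₁, hmem₁, hcoef₁, hreg₁ rAcc (by decide) (by decide) (by decide)] at l2
      rw [f1, f2, f3, f4, e9, e10]
      refine ⟨l1, Nat.mod_lt _ hq0, ?_, rfl, ?_⟩
      · rw [ZMod.natCast_mod, rowCoeff_succ, if_pos hmem, Nat.cast_mul, i3, Nat.cast_sub ht.le,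
          ZMod.natCast_self]
        push_cast
        ring
      · rw [l2, i5, i3, Finset.sum_range_succ, if_pos hb, add_assoc]
    · have hmem : j ∉ lowBits k M := fun h => hb (mem_lowBits.1 h).2
      have e9 := Nat.mod_eq_of_lt ((Nat.mul_lt_mul_self i2 ht.le).trans_le hqw)
      simp only [lowStep, eval_block_cons, eval_block_nil, eval_op, eval_ite, Op.eval,
        State.set_reg, State.set_mem, r0, r2, r3, r4, hrB, e2, e9, e10, i4, Nat.shiftRight_and_one,
        hb, Bool.false_eq_true, if_true, if_false, Nat.reduceEqDiff, OfNat.zero_ne_ofNat,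
        Nat.zero_mod, zero_ne_one]
      refine ⟨i1, Nat.mod_lt _ hq0, ?_, trivial, ?_⟩
      · rw [ZMod.natCast_mod, rowCoeff_succ, if_neg hmem, Nat.cast_mul, i3]
        push_cast
        ring
      · rw [i5, Finset.sum_range_succ, if_neg (by simpa using hb), add_zero]

/-- The registers that are fixed by the input have their intended values; `n`, `R` and `x` are the
number of start vertices, the number of moduli and the first modulus. -/
structure Fixed (n m k R x : ℕ) (s : State) : Prop where
  one : s.reg rOne = 1
  zero : s.reg rZero = 0
  edges : s.reg rEdges = m
  param : s.reg rK = k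
  verts : s.reg rVerts = n
  masks : s.reg rMasks = 2 ^ (2 * k)
  moduli : s.reg rModuli = R
  base : s.reg rBase = 3 + 2 * m
  first : s.reg rX = x

theorem Fixed.congr {n m k R x : ℕ} {s s' : State} (h : Fixed n m k R x s)
    (hs : ∀ r ≤ 8, s'.reg r = s.reg r) : Fixed n m k R x s' :=
  ⟨(hs _ (by norm_num)).trans h.one, (hs _ (by norm_num)).trans h.zero,
    (hs _ (by norm_num)).trans h.edges, (hs _ (by norm_num)).trans h.param,
    (hs _ (by norm_num)).trans h.verts, (hs _ (by norm_num)).trans h.masks,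
    (hs _ (by norm_num)).trans h.moduli, (hs _ (by norm_num)).trans h.base,
    (hs _ (by norm_num)).trans h.first⟩

/-- The words are long enough for the addresses and for products of two numbers up to `Q`. -/
structure FitsWord (w n m k Q : ℕ) : Prop where
  addr : 3 + 2 * m + n * 2 ^ (2 * k) < 2 ^ w
  sq : Q * Q ≤ 2 ^ w
  bits : 2 * k < w

/-- The address of the cell of the vertex `v` for the mask `N`. -/
def cell (m k v N : ℕ) : ℕ := 3 + 2 * m + v * 2 ^ (2 * k) + N

theorem cell_inj {m k v v' N N' : ℕ} (hN : N < 2 ^ (2 * k)) (hN' : N' < 2 ^ (2 * k)) :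
    cell m k v N = cell m k v' N' ↔ v = v' ∧ N = N' := by
  refine ⟨fun h => ?_, by rintro ⟨rfl, rfl⟩; rfl⟩
  have h1 : N + v * 2 ^ (2 * k) = N' + v' * 2 ^ (2 * k) := by unfold cell at h; omega
  have h2 := congrArg (· / 2 ^ (2 * k)) h1
  simp only [Nat.add_mul_div_right _ _ (Nat.two_pow_pos (2 * k)), Nat.div_eq_of_lt hN,
    Nat.div_eq_of_lt hN', zero_add] at h2
  subst h2
  exact ⟨rfl, by omega⟩

theorem FitsWord.cell_lt {w n m k Q v N : ℕ} (h : FitsWord w n m k Q) (hv : v < n)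
    (hN : N < 2 ^ (2 * k)) : cell m k v N < 2 ^ w := by
  have h1 : (v + 1) * 2 ^ (2 * k) ≤ n * 2 ^ (2 * k) := Nat.mul_le_mul_right _ hv
  have h2 := h.addr
  rw [Nat.succ_mul] at h1
  unfold cell
  omega

theorem le_cell (m k v N : ℕ) : 3 + 2 * m ≤ cell m k v N := by unfold cell; omega

/-- The value that the cell of `v` for the mask `M` has to get, as far as it comes from the arcs
in `as`. -/
def partialSum (arcs as : List Arc) (s k M v : ℕ) : ℤ :=
  (if v = s ∧ lowBits k M = ∅ ∧ highBits k M = ∅ then 1 else 0) +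
    (as.map fun a => if a.tgt = v then
      ∑ x ∈ lowBits k M, ∑ y ∈ highBits k M,
        rowCoeff a.label (lowBits k M) x * rowCoeff a.label (highBits k M) y *
          walkSum arcs s ((lowBits k M).erase x) ((highBits k M).erase y) a.src else 0).sum

theorem partialSum_self (arcs : List Arc) (s k M v : ℕ) :
    partialSum arcs arcs s k M v = walkSum arcs s (lowBits k M) (highBits k M) v := by
  rw [walkSum_eq]
  rfl

/-- The cells of the vertices in `W` for the masks below `M` hold the walk sums modulo `q`. -/
def CellsBelow (arcs : List Arc) (s q m k : ℕ) (W : Set ℕ) (M : ℕ) (mem : ℕ → ℕ) : Prop :=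
  ∀ v ∈ W, ∀ N < M, mem (cell m k v N) < q ∧ (mem (cell m k v N) : ZMod q) =
    ((walkSum arcs s (lowBits k N) (highBits k N) v : ℤ) : ZMod q)

/-- In addition, the cells for the mask `M` hold the contributions of the arcs in `as`. -/
def CellsPartial (arcs as : List Arc) (s q m k : ℕ) (W : Set ℕ) (M : ℕ) (mem : ℕ → ℕ) : Prop :=
  CellsBelow arcs s q m k W M mem ∧
    ∀ v ∈ W, mem (cell m k v M) < q ∧ (mem (cell m k v M) : ZMod q) =
      ((partialSum arcs as s k M v : ℤ) : ZMod q)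

theorem CellsPartial.cellsBelow_succ {arcs : List Arc} {s q m k : ℕ} {W : Set ℕ} {M : ℕ}
    {mem : ℕ → ℕ} (h : CellsPartial arcs arcs s q m k W M mem) :
    CellsBelow arcs s q m k W (M + 1) mem := by
  intro v hv N hN
  rcases Nat.lt_succ_iff_lt_or_eq.1 hN with hN | rfl
  · exact h.1 v hv N hN
  · rw [← partialSum_self]
    exact h.2 v hv

/-- The step accounts for one more arc in the cells for the current mask and leaves the input alone.
The cells that are read belong to smaller masks, so it does not matter that cells of the current
mask are incomplete. -/
theorem arcStep_spec {w n m k R x Q q t M u v : ℕ} {arcs as : List Arc} {r : ℕ} {W : Set ℕ}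
    (s : State) (hF : Fixed n m k R x s) (hw : FitsWord w n m k Q)
    (hv : v = rU ∨ v = rV) (hM : s.reg rMask = M) (hE : s.reg rE = t) (hq : s.reg rQ = q)
    (hNeg : s.reg rNeg = q - t) (ht : t < q) (hq2 : 2 ≤ q) (hqQ : q ≤ Q) (hMk : M < 2 ^ (2 * k))
    (hW : ∀ v ∈ W, v < n) (huW : s.reg u ∈ W) (hvW : s.reg v ∈ W)
    (hc : CellsPartial arcs as r q m k W M s.mem) :
    CellsPartial arcs (as ++ [⟨s.reg u, s.reg v, t⟩]) r q m k W M ((arcStep u v).eval w s).mem ∧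
      ∀ p < 3 + 2 * m, ((arcStep u v).eval w s).mem p = s.mem p := by
  have hKw : 2 ^ (2 * k) ≤ 2 ^ w := Nat.pow_le_pow_right (by norm_num) hw.bits.le
  have hqw : q * q ≤ 2 ^ w := (Nat.mul_le_mul hqQ hqQ).trans hw.sq
  have h1w : 1 < 2 ^ w := by nlinarith
  have bu := hw.cell_lt (hW _ huW) (Nat.two_pow_pos _)
  have bv := hw.cell_lt (hW _ hvW) hMk
  have e1 : s.reg u * 2 ^ (2 * k) % 2 ^ w = s.reg u * 2 ^ (2 * k) :=
    Nat.mod_eq_of_lt (by unfold cell at bu; omega)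
  have e2 : (3 + 2 * m + s.reg u * 2 ^ (2 * k)) % 2 ^ w = 3 + 2 * m + s.reg u * 2 ^ (2 * k) :=
    Nat.mod_eq_of_lt (by unfold cell at bu; omega)
  have e3 : s.reg v * 2 ^ (2 * k) % 2 ^ w = s.reg v * 2 ^ (2 * k) :=
    Nat.mod_eq_of_lt (by unfold cell at bv; omega)
  have e4 : (s.reg v * 2 ^ (2 * k) + (3 + 2 * m)) % 2 ^ w = s.reg v * 2 ^ (2 * k) + (3 + 2 * m) :=
    Nat.mod_eq_of_lt (by unfold cell at bv; omega)
  have e5 : (s.reg v * 2 ^ (2 * k) + (3 + 2 * m) + M) % 2 ^ w = cell m k (s.reg v) M := by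
    rw [← Nat.mod_eq_of_lt bv]; unfold cell; congr 1; ring
  have e6 : (1 + 0) % 2 ^ w = 1 := Nat.mod_eq_of_lt h1w
  have v1 : v ≠ rTmp := by omega
  have v2 : v ≠ rSrc := by omega
  obtain ⟨y, hy1, hy2, hy3⟩ : ∃ y, ((arcStep u v).eval w s).mem =
      Function.update s.mem (cell m k (s.reg v) M) y ∧ y < q ∧
      (y : ZMod q) = s.mem (cell m k (s.reg v) M) +
        ∑ x ∈ lowBits k M, ∑ y ∈ highBits k M,
          ((rowCoeff t (lowBits k M) x : ℤ) : ZMod q) *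
          ((rowCoeff t (highBits k M) y : ℤ) : ZMod q) *
          (s.mem (cell m k (s.reg u) (M ^^^ 2 ^ x ^^^ 2 ^ (k + y))) : ZMod q) := by
    simp only [arcStep, eval_block_cons, eval_block_nil, eval_op, eval_load, eval_store, Op.eval,
      State.set_reg, State.set_mem, hF.one, hF.zero, hF.masks, hF.base, hM, v1, v2, e1, e2,
      e3, e4, e5, e6, if_true, if_false, Nat.reduceEqDiff, OfNat.zero_ne_ofNat,
      OfNat.one_ne_ofNat]
    generalize hs₁ : (((((((s.set rTmp (s.reg u * 2 ^ (2 * k))).set rSrc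
      (3 + 2 * m + s.reg u * 2 ^ (2 * k))).set rTmp (s.reg v * 2 ^ (2 * k))).set rTmp
      (s.reg v * 2 ^ (2 * k) + (3 + 2 * m))).set rDst (cell m k (s.reg v) M)).set rAcc
      (s.mem (cell m k (s.reg v) M))).set rCoef 1) = s₁
    have hmem₁ : s₁.mem = s.mem := by rw [← hs₁]; rfl
    have hreg₁ : ∀ r, r ≠ rTmp → r ≠ rSrc → r ≠ rDst → r ≠ rAcc → r ≠ rCoef →
        s₁.reg r = s.reg r := by
      intro r h1 h2 h3 h4 h5
      simp [← hs₁, State.set_reg, h1, h2, h3, h4, h5]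
    have hsrc₁ : s₁.reg rSrc = 3 + 2 * m + s.reg u * 2 ^ (2 * k) := by
      simp [← hs₁, State.set_reg]
    have hdst₁ : s₁.reg rDst = cell m k (s.reg v) M := by simp [← hs₁, State.set_reg]
    have hacc₁ : s₁.reg rAcc = s.mem (cell m k (s.reg v) M) := by simp [← hs₁, State.set_reg]
    have hcoef₁ : s₁.reg rCoef = 1 := by simp [← hs₁, State.set_reg]
    obtain ⟨l1, l2⟩ := lowLoop_spec (w := w) (k := k) (M := M) (q := q) (t := t) s₁
      (by simp [hreg₁, hF.one]) (by simp [hreg₁, hF.zero]) (by simp [hreg₁, hF.param])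
      (by simp [hreg₁, hM]) (by simp [hreg₁, hE]) (by simp [hreg₁, hq]) (by simp [hreg₁, hNeg])
      hcoef₁ (by rw [hacc₁]; exact (hc.2 _ hvW).1) ht hq2 hqw hw.bits hMk
      (by rw [hsrc₁]; exact fun N hN => hw.cell_lt (hW _ huW) hN)
      (by
        rw [hsrc₁, hmem₁]
        exact fun x hx y hy => (hc.1 _ huW _ (Nat.xor_two_pow_xor_two_pow_lt hx hy)).1)
    rw [hsrc₁, hmem₁, hacc₁] at l2
    have f1 : ((loop rCol rK lowStep).eval w s₁).reg rDst = cell m k (s.reg v) M :=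
      (eval_reg_of_notMem_writes w _ (by decide) s₁).trans hdst₁
    have f2 : ((loop rCol rK lowStep).eval w s₁).mem = s.mem :=
      (eval_mem_of_storeless w (loop rCol rK lowStep)
        (by simp [Storeless, lowStep, highStep, block]) s₁).trans hmem₁
    exact ⟨_, by rw [f1, f2], l1, l2⟩
  rw [hy1]
  refine ⟨⟨fun v' hv' N hN => ?_, fun v' hv' => ?_⟩, fun p hp => ?_⟩
  · rw [Function.update_of_ne]
    · exact hc.1 v' hv' N hN
    · rw [ne_eq, cell_inj (hN.trans hMk) hMk]
      omega
  · by_cases hvv : s.reg v = v'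
    · subst hvv
      rw [Function.update_self]
      refine ⟨hy2, ?_⟩
      rw [hy3, (hc.2 _ hvW).2, partialSum, partialSum, List.map_append, List.sum_append,
        List.map_singleton, List.sum_singleton, if_pos rfl, ← add_assoc,
        Int.cast_add _ (Finset.sum _ _)]
      congr 1
      push_cast
      refine Finset.sum_congr rfl fun x hx => Finset.sum_congr rfl fun y hy => ?_
      rw [(hc.1 _ huW _ (Nat.xor_two_pow_xor_two_pow_lt hx hy)).2, lowBits_xor hx,
        highBits_xor hx hy]
    · rw [Function.update_of_ne]
      · rw [partialSum, List.map_append, List.sum_append, List.map_singleton, List.sum_singleton,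
          if_neg hvv, add_zero]
        exact hc.2 v' hv'
      · rw [ne_eq, cell_inj hMk hMk]
        exact fun h => hvv h.1.symm
  · rw [Function.update_of_ne]
    have := le_cell m k (s.reg v) M
    omega

/-- Load the ends of the edge `rE`. -/
def fetchEdge : Cmd := block [
  const rTmp 3,
  op .add rTmp2 rE rE,
  op .add rTmp rTmp rTmp2,
  load rU rTmp,
  op .add rTmp rTmp rOne,
  load rV rTmp]

/-- Write register `b` to the cell of the vertex in register `v` for the current mask. -/
def storeCell (v b : ℕ) : Cmd := block [
  op .mul rTmp v rMasks,
  op .add rTmp rTmp rBase,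
  op .add rTmp rTmp rMask,
  store rTmp b]

/-- Clear the cells of the ends of the edge `rE`. -/
def clearStep : Cmd := block [fetchEdge, storeCell rU rZero, storeCell rV rZero]

/-- Add the contributions of the arcs given by the edge `rE`. -/
def edgeStep (und : Bool) : Cmd := block [
  fetchEdge,
  op .sub rNeg rQ rE,
  arcStep rU rV,
  if und then arcStep rV rU else skip]

/-- Compute the cells for the current mask. Only cells of the start vertex and of ends of edges are
touched, so that the time does not depend on the number of vertices. -/
def maskStep (und : Bool) : Cmd := block [
  storeCell rS rZero,
  loop rE rEdges clearStep,
  ite rMask rZero (storeCell rS rOne) skip,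
  loop rE rEdges (edgeStep und)]

/-- Compute all cells for the start vertex `rS` modulo the current modulus, and answer YES if the
cell of the start vertex for the full mask is not zero. -/
def modulusStep (und : Bool) : Cmd := block [
  op .add rQ rX rJ,
  loop rMask rMasks (maskStep und),
  op .mul rTmp rS rMasks,
  op .add rTmp rTmp rBase,
  op .add rTmp rTmp rMasks,
  op .sub rTmp rTmp rOne,
  load rTmp rTmp,
  ite rTmp rZero skip (const rAns 1)]

/-- The part of the program after the computation of the registers `rOne`, …, `rAns`. -/
def mainLoop (und : Bool) : Cmd := loop rS rVerts (loop rJ rModuli (modulusStep und))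

theorem Op.eval_sub {w x y : ℕ} (hyx : y ≤ x) (hx : x < 2 ^ w) : Op.sub.eval w x y = x - y := by
  rw [Op.eval, show x + (2 ^ w - y) = x - y + 2 ^ w by omega, Nat.add_mod_right,
    Nat.mod_eq_of_lt (by omega)]

theorem storeCell_spec {w n m k R x Q M v b : ℕ} (s : State) (hF : Fixed n m k R x s)
    (hw : FitsWord w n m k Q) (hb : b ≠ rTmp) (hM : s.reg rMask = M) (hMk : M < 2 ^ (2 * k))
    (hv : s.reg v < n) :
    ((storeCell v b).eval w s).mem = Function.update s.mem (cell m k (s.reg v) M) (s.reg b) := by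
  have bv := hw.cell_lt hv hMk
  have e3 : s.reg v * 2 ^ (2 * k) % 2 ^ w = s.reg v * 2 ^ (2 * k) :=
    Nat.mod_eq_of_lt (by unfold cell at bv; omega)
  have e4 : (s.reg v * 2 ^ (2 * k) + (3 + 2 * m)) % 2 ^ w = s.reg v * 2 ^ (2 * k) + (3 + 2 * m) :=
    Nat.mod_eq_of_lt (by unfold cell at bv; omega)
  have e5 : (s.reg v * 2 ^ (2 * k) + (3 + 2 * m) + M) % 2 ^ w = cell m k (s.reg v) M := by
    rw [← Nat.mod_eq_of_lt bv]; unfold cell; congr 1; ring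
  simp only [storeCell, eval_block_cons, eval_block_nil, eval_op, eval_store, Op.eval,
    State.set_reg, State.set_mem, hF.masks, hF.base, hM, hb, e3, e4, e5, if_true, if_false,
    Nat.reduceEqDiff]

theorem fetchEdge_spec {w n m k R x Q e : ℕ} (s : State) (hF : Fixed n m k R x s)
    (hw : FitsWord w n m k Q) (hE : s.reg rE = e) (he : e < m) :
    (fetchEdge.eval w s).reg rU = s.mem (3 + 2 * e) ∧
      (fetchEdge.eval w s).reg rV = s.mem (4 + 2 * e) := by
  have := hw.addr
  have e0 : 3 % 2 ^ w = 3 := Nat.mod_eq_of_lt (by omega)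
  have e1 : (e + e) % 2 ^ w = e + e := Nat.mod_eq_of_lt (by omega)
  have e2 : (3 + (e + e)) % 2 ^ w = 3 + (e + e) := Nat.mod_eq_of_lt (by omega)
  have e3 : (3 + (e + e) + 1) % 2 ^ w = 3 + (e + e) + 1 := Nat.mod_eq_of_lt (by omega)
  simp only [fetchEdge, eval_block_cons, eval_block_nil, eval_op, eval_const, eval_load, Op.eval,
    State.set_reg, State.set_mem, hF.one, hE, e0, e1, e2, e3, if_true, if_false,
    Nat.reduceEqDiff, OfNat.zero_ne_ofNat]
  constructor <;> congr 1 <;> ring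

/-- The vertices whose cells are used for the start vertex `r`. -/
def activeVerts (U V : ℕ → ℕ) (m r : ℕ) : Set ℕ := {v | v = r ∨ ∃ i < m, v = U i ∨ v = V i}

/-- After the loop, all cells that are used for the mask `M` are zero; the memory outside the cells
for `M` is unchanged. -/
theorem clearLoop_spec {w n m k R x Q M r : ℕ} {U V : ℕ → ℕ} (s : State)
    (hF : Fixed n m k R x s) (hw : FitsWord w n m k Q) (hM : s.reg rMask = M)
    (hMk : M < 2 ^ (2 * k)) (hU : ∀ i < m, s.mem (3 + 2 * i) = U i)
    (hV : ∀ i < m, s.mem (4 + 2 * i) = V i) (hW : ∀ v ∈ activeVerts U V m r, v < n)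
    (hr : s.mem (cell m k r M) = 0) :
    let s' := (loop rE rEdges clearStep).eval w s
    (∀ p, (∀ v, p ≠ cell m k v M) → s'.mem p = s.mem p) ∧
      ∀ v ∈ activeVerts U V m r, s'.mem (cell m k v M) = 0 := by
  have key := loop_induction (w := w) (i := rE) (n := rEdges) (c := clearStep) (s := s)
    (fun j s' => (∀ p, (∀ v, p ≠ cell m k v M) → s'.mem p = s.mem p) ∧
      ∀ v ∈ activeVerts U V j r, s'.mem (cell m k v M) = 0) ?_ ?_
  · rw [hF.edges] at key
    exact key
  · refine ⟨fun p _ => rfl, ?_⟩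
    rintro v (rfl | ⟨i, hi, -⟩)
    · exact hr
    · omega
  · rintro j hj s' hr' hrE ⟨i1, i2⟩
    rw [hF.edges] at hj
    have hF' : Fixed n m k R x s' := hF.congr fun r hr => hr' r (by interval_cases r <;> decide)
    have hM' : s'.reg rMask = M := (hr' _ (by decide)).trans hM
    obtain ⟨hu, hv⟩ := fetchEdge_spec s' hF' hw hrE hj
    rw [i1 _ (fun v => by have := le_cell m k v M; omega), hU j hj] at hu
    rw [i1 _ (fun v => by have := le_cell m k v M; omega), hV j hj] at hv
    have hmem : (fetchEdge.eval w s').mem = s'.mem :=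
      eval_mem_of_storeless w _ (by simp [Storeless, fetchEdge, block]) s'
    have hF₁ : Fixed n m k R x (fetchEdge.eval w s') := hF'.congr fun r hr =>
      eval_reg_of_notMem_writes w _ (by interval_cases r <;> decide) s'
    have hM₁ : (fetchEdge.eval w s').reg rMask = M :=
      (eval_reg_of_notMem_writes w _ (by decide) s').trans hM'
    simp only [clearStep, eval_block_cons, eval_block_nil, State.set_mem]
    generalize fetchEdge.eval w s' = s₁ at *
    have m₁ := storeCell_spec (v := rU) (b := rZero) s₁ hF₁ hw (by decide) hM₁ hMk
      (by rw [hu]; exact hW _ (Or.inr ⟨j, hj, Or.inl rfl⟩))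
    have hF₂ : Fixed n m k R x ((storeCell rU rZero).eval w s₁) := hF₁.congr fun r hr =>
      eval_reg_of_notMem_writes w _ (by interval_cases r <;> decide) s₁
    have hM₂ : ((storeCell rU rZero).eval w s₁).reg rMask = M :=
      (eval_reg_of_notMem_writes w _ (by decide) s₁).trans hM₁
    have hv₂ : ((storeCell rU rZero).eval w s₁).reg rV = V j :=
      (eval_reg_of_notMem_writes w _ (by decide) s₁).trans hv
    have m₂ := storeCell_spec (v := rV) (b := rZero) _ hF₂ hw (by decide) hM₂ hMk
      (by rw [hv₂]; exact hW _ (Or.inr ⟨j, hj, Or.inr rfl⟩))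
    rw [hu, hF₁.zero, hmem] at m₁
    rw [hv₂, hF₂.zero, m₁] at m₂
    rw [m₂]
    refine ⟨fun p hp => ?_, ?_⟩
    · rw [Function.update_of_ne (hp _), Function.update_of_ne (hp _), i1 p hp]
    · intro v hv'
      simp only [Function.update_apply, cell_inj hMk hMk, and_true]
      split_ifs with h1 h2
      · rfl
      · rfl
      · refine i2 v ?_
        rcases hv' with rfl | ⟨i, hi, h⟩
        · exact Or.inl rfl
        · rcases Nat.lt_succ_iff_lt_or_eq.1 hi with hi | rfl
          · exact Or.inr ⟨i, hi, h⟩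
          · rcases h with h | h
            exacts [absurd h h2, absurd h h1]

theorem labelledArcs_succ (und : Bool) (U V : ℕ → ℕ) (m : ℕ) :
    labelledArcs und U V (m + 1) =
      labelledArcs und U V m ++ ⟨U m, V m, m⟩ :: if und then [⟨V m, U m, m⟩] else [] := by
  simp [labelledArcs, List.range_succ]

/-- The loop accounts for all arcs in the cells for the mask `M`. -/
theorem edgeLoop_spec {w n m k R x Q q M r : ℕ} {U V : ℕ → ℕ} {und : Bool} {arcs : List Arc}
    (s : State) (hF : Fixed n m k R x s) (hw : FitsWord w n m k Q) (hM : s.reg rMask = M)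
    (hq : s.reg rQ = q) (hMk : M < 2 ^ (2 * k)) (hU : ∀ i < m, s.mem (3 + 2 * i) = U i)
    (hV : ∀ i < m, s.mem (4 + 2 * i) = V i) (hW : ∀ v ∈ activeVerts U V m r, v < n)
    (hq2 : 2 ≤ q) (hqQ : q ≤ Q) (hmq : m ≤ q)
    (hc : CellsPartial arcs [] r q m k (activeVerts U V m r) M s.mem) :
    let s' := (loop rE rEdges (edgeStep und)).eval w s
    CellsPartial arcs (labelledArcs und U V m) r q m k (activeVerts U V m r) M s'.mem ∧
      ∀ p < 3 + 2 * m, s'.mem p = s.mem p := by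
  have hqw : q < 2 ^ w :=
    (show q < q * q by nlinarith).trans_le ((Nat.mul_le_mul hqQ hqQ).trans hw.sq)
  have key := loop_induction (w := w) (i := rE) (n := rEdges) (c := edgeStep und) (s := s)
    (fun j s' => CellsPartial arcs (labelledArcs und U V j) r q m k (activeVerts U V m r) M s'.mem ∧
      ∀ p < 3 + 2 * m, s'.mem p = s.mem p) ?_ ?_
  · rw [hF.edges] at key
    exact key
  · exact ⟨hc, fun p _ => rfl⟩
  · rintro j hj s' hr' hrE ⟨i1, i2⟩
    rw [hF.edges] at hj
    have hF' : Fixed n m k R x s' := hF.congr fun r hr => hr' r (by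
      cases und <;> interval_cases r <;> decide)
    have hM' : s'.reg rMask = M := (hr' _ (by cases und <;> decide)).trans hM
    have hq' : s'.reg rQ = q := (hr' _ (by cases und <;> decide)).trans hq
    obtain ⟨hu, hv⟩ := fetchEdge_spec s' hF' hw hrE hj
    rw [i2 _ (by omega), hU j hj] at hu
    rw [i2 _ (by omega), hV j hj] at hv
    have huW : U j ∈ activeVerts U V m r := Or.inr ⟨j, hj, Or.inl rfl⟩
    have hvW : V j ∈ activeVerts U V m r := Or.inr ⟨j, hj, Or.inr rfl⟩
    have hmem : (fetchEdge.eval w s').mem = s'.mem :=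
      eval_mem_of_storeless w _ (by simp [Storeless, fetchEdge, block]) s'
    have hreg : ∀ r ∉ fetchEdge.writes, (fetchEdge.eval w s').reg r = s'.reg r :=
      fun r hr => eval_reg_of_notMem_writes w _ hr s'
    rw [labelledArcs_succ]
    simp only [edgeStep, eval_block_cons, eval_block_nil, State.set_mem, eval_op]
    rw [hreg rQ (by decide), hreg rE (by decide), hq', hrE, Op.eval_sub (by omega) hqw]
    -- the state after the ends of the edge are loaded
    generalize hs₁ : (fetchEdge.eval w s').set rNeg (q - j) = s₁
    have hmem₁ : s₁.mem = s'.mem := by rw [← hs₁]; exact hmem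
    have hreg₁ : ∀ r ∉ rNeg :: fetchEdge.writes, s₁.reg r = s'.reg r := by
      intro r hr
      rw [List.mem_cons, not_or] at hr
      rw [← hs₁, State.set_reg, if_neg hr.1, hreg r hr.2]
    have hF₁ : Fixed n m k R x s₁ := hF'.congr fun r hr =>
      hreg₁ r (by interval_cases r <;> decide)
    have hM₁ : s₁.reg rMask = M := (hreg₁ _ (by decide)).trans hM'
    have hE₁ : s₁.reg rE = j := (hreg₁ _ (by decide)).trans hrE
    have hq₁ : s₁.reg rQ = q := (hreg₁ _ (by decide)).trans hq'
    have hNeg₁ : s₁.reg rNeg = q - j := by simp [← hs₁, State.set_reg]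
    have hu₁ : s₁.reg rU = U j := by simp [← hs₁, State.set_reg, hu]
    have hv₁ : s₁.reg rV = V j := by simp [← hs₁, State.set_reg, hv]
    obtain ⟨c1, c2⟩ := arcStep_spec (u := rU) (v := rV) s₁ hF₁ hw (Or.inr rfl) hM₁ hE₁ hq₁ hNeg₁
      (by omega) hq2 hqQ hMk hW (by rwa [hu₁]) (by rwa [hv₁]) (by rw [hmem₁]; exact i1)
    rw [hu₁, hv₁] at c1
    cases und with
    | false =>
      exact ⟨c1, fun p hp => by rw [← i2 p hp, ← hmem₁, ← c2 p hp]; rfl⟩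
    | true =>
      have hreg₂ : ∀ r ∉ (arcStep rU rV).writes, ((arcStep rU rV).eval w s₁).reg r = s₁.reg r :=
        fun r hr => eval_reg_of_notMem_writes w _ hr s₁
      have hu₂ := (hreg₂ rU (by decide)).trans hu₁
      have hv₂ := (hreg₂ rV (by decide)).trans hv₁
      obtain ⟨d1, d2⟩ := arcStep_spec (u := rV) (v := rU) ((arcStep rU rV).eval w s₁)
        (hF₁.congr fun r hr => hreg₂ r (by interval_cases r <;> decide)) hw (Or.inl rfl)
        ((hreg₂ _ (by decide)).trans hM₁) ((hreg₂ _ (by decide)).trans hE₁)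
        ((hreg₂ _ (by decide)).trans hq₁) ((hreg₂ _ (by decide)).trans hNeg₁)
        (by omega) hq2 hqQ hMk hW (by rwa [hv₂]) (by rwa [hu₂]) c1
      rw [hu₂, hv₂, List.append_assoc] at d1
      exact ⟨d1, fun p hp => by rw [← i2 p hp, ← hmem₁, ← c2 p hp, ← d2 p hp]; rfl⟩

/-- After the loop over the masks, every cell that is used holds its walk sum modulo `q`. -/
theorem maskLoop_spec {w n m k R x Q q r : ℕ} {U V : ℕ → ℕ} {und : Bool}
    (s : State) (hF : Fixed n m k R x s) (hw : FitsWord w n m k Q) (hS : s.reg rS = r)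
    (hq : s.reg rQ = q) (hU : ∀ i < m, s.mem (3 + 2 * i) = U i)
    (hV : ∀ i < m, s.mem (4 + 2 * i) = V i) (hW : ∀ v ∈ activeVerts U V m r, v < n)
    (hq2 : 2 ≤ q) (hqQ : q ≤ Q) (hmq : m ≤ q) :
    let s' := (loop rMask rMasks (maskStep und)).eval w s
    CellsBelow (labelledArcs und U V m) r q m k (activeVerts U V m r) (2 ^ (2 * k)) s'.mem ∧
      ∀ p < 3 + 2 * m, s'.mem p = s.mem p := by
  have key := loop_induction (w := w) (i := rMask) (n := rMasks) (c := maskStep und) (s := s)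
    (fun j s' => CellsBelow (labelledArcs und U V m) r q m k (activeVerts U V m r) j s'.mem ∧
      ∀ p < 3 + 2 * m, s'.mem p = s.mem p) ?_ ?_
  · rw [hF.masks] at key
    exact key
  · exact ⟨fun v _ N hN => absurd hN (Nat.not_lt_zero N), fun p _ => rfl⟩
  · rintro M hM s' hr' hrM ⟨i1, i2⟩
    rw [hF.masks] at hM
    have hrn : r < n := hW r (Or.inl rfl)
    have hF' : Fixed n m k R x s' := hF.congr fun r hr => hr' r (by
      cases und <;> interval_cases r <;> decide)
    have hS' : s'.reg rS = r := (hr' _ (by cases und <;> decide)).trans hS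
    have hq' : s'.reg rQ = q := (hr' _ (by cases und <;> decide)).trans hq
    simp only [maskStep, eval_block_cons, eval_block_nil, State.set_mem]
    -- clear the cell of the start vertex
    have m₁ := storeCell_spec (v := rS) (b := rZero) s' hF' hw (by decide) hrM hM (by rwa [hS'])
    rw [hS', hF'.zero] at m₁
    have hreg₁ : ∀ r ∉ (storeCell rS rZero).writes,
        ((storeCell rS rZero).eval w s').reg r = s'.reg r :=
      fun r hr => eval_reg_of_notMem_writes w _ hr s'
    generalize (storeCell rS rZero).eval w s' = s₁ at *
    have hF₁ : Fixed n m k R x s₁ := hF'.congr fun r hr =>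
      hreg₁ r (by interval_cases r <;> decide)
    have hM₁ : s₁.reg rMask = M := (hreg₁ _ (by decide)).trans hrM
    have hS₁ : s₁.reg rS = r := (hreg₁ _ (by decide)).trans hS'
    have hq₁ : s₁.reg rQ = q := (hreg₁ _ (by decide)).trans hq'
    have hin₁ : ∀ p < 3 + 2 * m, s₁.mem p = s.mem p := fun p hp => by
      have := le_cell m k r M
      rw [m₁, Function.update_of_ne (by omega), i2 p hp]
    -- clear the other cells
    obtain ⟨a1, a2⟩ := clearLoop_spec s₁ hF₁ hw hM₁ hM (fun i hi => by
      rw [hin₁ _ (by omega), hU i hi]) (fun i hi => by rw [hin₁ _ (by omega), hV i hi]) hW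
      (by rw [m₁, Function.update_self])
    have hreg₂ : ∀ r ∉ (loop rE rEdges clearStep).writes,
        ((loop rE rEdges clearStep).eval w s₁).reg r = s₁.reg r :=
      fun r hr => eval_reg_of_notMem_writes w _ hr s₁
    generalize (loop rE rEdges clearStep).eval w s₁ = s₂ at *
    have hF₂ : Fixed n m k R x s₂ := hF₁.congr fun r hr =>
      hreg₂ r (by interval_cases r <;> decide)
    have hM₂ : s₂.reg rMask = M := (hreg₂ _ (by decide)).trans hM₁
    have hS₂ : s₂.reg rS = r := (hreg₂ _ (by decide)).trans hS₁
    have hq₂ : s₂.reg rQ = q := (hreg₂ _ (by decide)).trans hq₁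
    have hin₂ : ∀ p < 3 + 2 * m, s₂.mem p = s.mem p := fun p hp => by
      rw [a1 p (fun v => by have := le_cell m k v M; omega), hin₁ p hp]
    have hbelow₂ : ∀ v, ∀ N < M, s₂.mem (cell m k v N) = s'.mem (cell m k v N) := by
      intro v N hN
      have hne : ∀ v', cell m k v N ≠ cell m k v' M := fun v' h =>
        hN.ne ((cell_inj (hN.trans hM) hM).1 h).2
      rw [a1 _ hne, m₁, Function.update_of_ne (hne _)]
    -- initialize the cell of the start vertex for the empty mask
    obtain ⟨b1, b2, b3⟩ : (∀ p, (∀ v, p ≠ cell m k v M) →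
          ((ite rMask rZero (storeCell rS rOne) skip).eval w s₂).mem p = s₂.mem p) ∧
        (∀ v ∈ activeVerts U V m r,
          ((ite rMask rZero (storeCell rS rOne) skip).eval w s₂).mem (cell m k v M) =
            if v = r ∧ M = 0 then 1 else 0) ∧
        ∀ r ∉ (ite rMask rZero (storeCell rS rOne) skip).writes,
          ((ite rMask rZero (storeCell rS rOne) skip).eval w s₂).reg r = s₂.reg r := by
      refine ⟨fun p hp => ?_, fun v hv => ?_, fun r hr => eval_reg_of_notMem_writes w _ hr s₂⟩
      · rw [eval_ite]
        split_ifs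
        · rw [storeCell_spec s₂ hF₂ hw (by decide) hM₂ hM (by rwa [hS₂]),
            Function.update_of_ne (hp _)]
        · rfl
      · rw [eval_ite, hM₂, hF₂.zero]
        by_cases h0 : M = 0
        · rw [if_pos h0, storeCell_spec s₂ hF₂ hw (by decide) hM₂ hM (by rwa [hS₂]), hS₂, hF₂.one,
            Function.update_apply]
          simp only [cell_inj hM hM, and_true]
          simp only [h0, and_true]
          split_ifs with h
          · rfl
          · simpa only [h0] using a2 v hv
        · rw [if_neg h0, if_neg (fun h => h0 h.2)]
          exact a2 v hv
    generalize (ite rMask rZero (storeCell rS rOne) skip).eval w s₂ = s₃ at *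
    have hbelow₃ : ∀ v, ∀ N < M, s₃.mem (cell m k v N) = s'.mem (cell m k v N) := by
      intro v N hN
      rw [b1 _ fun v' h => hN.ne ((cell_inj (hN.trans hM) hM).1 h).2, hbelow₂ v N hN]
    have hin₃ : ∀ p < 3 + 2 * m, s₃.mem p = s.mem p := fun p hp => by
      rw [b1 p (fun v => by have := le_cell m k v M; omega), hin₂ p hp]
    have hc₃ : CellsPartial (labelledArcs und U V m) [] r q m k (activeVerts U V m r) M s₃.mem := by
      refine ⟨fun v hv N hN => ?_, fun v hv => ?_⟩
      · rw [hbelow₃ v N hN]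
        exact i1 v hv N hN
      · rw [b2 v hv, partialSum, List.map_nil, List.sum_nil, add_zero]
        have hiff : (v = r ∧ lowBits k M = ∅ ∧ highBits k M = ∅) ↔ (v = r ∧ M = 0) :=
          and_congr_right fun _ => ⟨fun h => eq_zero_of_lowBits_of_highBits hM h.1 h.2, by
            rintro rfl; exact ⟨lowBits_zero k, highBits_zero k⟩⟩
        simp only [hiff]
        split_ifs
        · exact ⟨by omega, by simp⟩
        · exact ⟨by omega, by simp⟩
    obtain ⟨d1, d2⟩ := edgeLoop_spec (und := und) s₃
      (hF₂.congr fun r hr => b3 r (by interval_cases r <;> decide)) hw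
      ((b3 _ (by decide)).trans hM₂) ((b3 _ (by decide)).trans hq₂) hM
      (fun i hi => by rw [hin₃ _ (by omega), hU i hi])
      (fun i hi => by rw [hin₃ _ (by omega), hV i hi]) hW hq2 hqQ hmq hc₃
    exact ⟨d1.cellsBelow_succ, fun p hp => by rw [d2 p hp, hin₃ p hp]⟩

/-- The answer becomes YES if the sum over the closed walks at `r` does not vanish modulo `q`. -/
theorem modulusStep_spec {w n m k R x Q q r j : ℕ} {U V : ℕ → ℕ} {und : Bool}
    (s : State) (hF : Fixed n m k R x s) (hw : FitsWord w n m k Q) (hS : s.reg rS = r)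
    (hJ : s.reg rJ = j) (hq : x + j = q) (hU : ∀ i < m, s.mem (3 + 2 * i) = U i)
    (hV : ∀ i < m, s.mem (4 + 2 * i) = V i) (hW : ∀ v ∈ activeVerts U V m r, v < n)
    (hq2 : 2 ≤ q) (hqQ : q ≤ Q) (hmq : m ≤ q) :
    let s' := (modulusStep und).eval w s
    (s'.reg rAns = 1 ↔ s.reg rAns = 1 ∨ ¬ (q : ℤ) ∣
      walkSum (labelledArcs und U V m) r (Finset.range k) (Finset.range k) r) ∧
      ∀ p < 3 + 2 * m, s'.mem p = s.mem p := by
  have hqw : q < 2 ^ w :=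
    (show q < q * q by nlinarith).trans_le ((Nat.mul_le_mul hqQ hqQ).trans hw.sq)
  have hKpos := Nat.two_pow_pos (2 * k)
  have hrW : r ∈ activeVerts U V m r := Or.inl rfl
  have e1 : (x + j) % 2 ^ w = q := by rw [hq, Nat.mod_eq_of_lt hqw]
  simp only [modulusStep, eval_block_cons, eval_block_nil, eval_op (o := .add) (d := rQ), Op.eval,
    hF.first, hJ, e1]
  have hF₁ : Fixed n m k R x (s.set rQ q) := hF.congr fun r hr => by
    rw [State.set_reg, if_neg (by omega)]
  obtain ⟨c1, c2⟩ := maskLoop_spec (und := und) (s.set rQ q) hF₁ hw (by simp [State.set_reg, hS])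
    (by simp [State.set_reg]) hU hV hW hq2 hqQ hmq
  have hreg₂ : ∀ r ∉ (loop rMask rMasks (maskStep und)).writes,
      ((loop rMask rMasks (maskStep und)).eval w (s.set rQ q)).reg r = (s.set rQ q).reg r :=
    fun r hr => eval_reg_of_notMem_writes w _ hr _
  generalize (loop rMask rMasks (maskStep und)).eval w (s.set rQ q) = s₂ at *
  have hF₂ : Fixed n m k R x s₂ := hF₁.congr fun r hr =>
    hreg₂ r (by cases und <;> interval_cases r <;> decide)
  have hS₂ : s₂.reg rS = r :=
    (hreg₂ _ (by cases und <;> decide)).trans (by simp [State.set_reg, hS])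
  have hA₂ : s₂.reg rAns = s.reg rAns :=
    (hreg₂ _ (by cases und <;> decide)).trans (by simp [State.set_reg])
  have hwa := hw.addr
  have h1w : 1 < 2 ^ w := by omega
  have hlast : 2 ^ (2 * k) - 1 < 2 ^ (2 * k) := by omega
  have bv := hw.cell_lt (hW _ hrW) hlast
  have hrn : (r + 1) * 2 ^ (2 * k) ≤ n * 2 ^ (2 * k) := Nat.mul_le_mul_right _ (hW r hrW)
  rw [Nat.succ_mul] at hrn
  have e2 : r * 2 ^ (2 * k) % 2 ^ w = r * 2 ^ (2 * k) := Nat.mod_eq_of_lt (by omega)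
  have e3 : (r * 2 ^ (2 * k) + (3 + 2 * m)) % 2 ^ w = r * 2 ^ (2 * k) + (3 + 2 * m) :=
    Nat.mod_eq_of_lt (by omega)
  have e4 : (r * 2 ^ (2 * k) + (3 + 2 * m) + 2 ^ (2 * k)) % 2 ^ w =
      r * 2 ^ (2 * k) + (3 + 2 * m) + 2 ^ (2 * k) := Nat.mod_eq_of_lt (by omega)
  have e5 : Op.sub.eval w (r * 2 ^ (2 * k) + (3 + 2 * m) + 2 ^ (2 * k)) 1 =
      cell m k r (2 ^ (2 * k) - 1) := by
    rw [Op.eval_sub (by omega) (by omega)]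
    unfold cell
    omega
  have e6 : ∀ y z, Op.add.eval w y z = (y + z) % 2 ^ w := fun _ _ => rfl
  have e7 : ∀ y z, Op.mul.eval w y z = (y * z) % 2 ^ w := fun _ _ => rfl
  obtain ⟨c3, c4⟩ := c1 r hrW _ hlast
  rw [lowBits_top, highBits_top] at c4
  have hzero : s₂.mem (cell m k r (2 ^ (2 * k) - 1)) = 0 ↔ (q : ℤ) ∣
      walkSum (labelledArcs und U V m) r (Finset.range k) (Finset.range k) r := by
    rw [← ZMod.intCast_zmod_eq_zero_iff_dvd, ← c4, ZMod.natCast_eq_zero_iff]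
    exact ⟨fun h => h ▸ dvd_zero q, fun h => Nat.eq_zero_of_dvd_of_lt h c3⟩
  simp only [eval_op, eval_load, eval_ite, eval_const, e6, e7, State.set_reg, State.set_mem,
    hF₂.one, hF₂.zero, hF₂.masks, hF₂.base, hS₂, e2, e3, e4, e5, if_true, if_false,
    Nat.reduceEqDiff, OfNat.zero_ne_ofNat, OfNat.one_ne_ofNat, Nat.mod_eq_of_lt h1w, hzero]
  split_ifs with h
  · refine ⟨?_, c2⟩
    simp [eval, State.set_reg, hA₂, h]
  · refine ⟨?_, c2⟩
    simp [State.set_reg, h]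

/-- The effect of the main loop on the answer register. -/
theorem mainLoop_spec {w n m k R x Q : ℕ} {U V : ℕ → ℕ} {und : Bool}
    (s : State) (hF : Fixed n m k R x s) (hw : FitsWord w n m k Q)
    (hU : ∀ i < m, s.mem (3 + 2 * i) = U i) (hV : ∀ i < m, s.mem (4 + 2 * i) = V i)
    (hUn : ∀ i < m, U i < n) (hVn : ∀ i < m, V i < n) (hx2 : 2 ≤ x) (hxQ : x + R ≤ Q)
    (hmx : m ≤ x) :
    ((mainLoop und).eval w s).reg rAns = 1 ↔ s.reg rAns = 1 ∨ ∃ r < n, ∃ j < R,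
      ¬ ((x + j : ℕ) : ℤ) ∣
        walkSum (labelledArcs und U V m) r (Finset.range k) (Finset.range k) r := by
  have key := loop_induction (w := w) (i := rS) (n := rVerts)
    (c := loop rJ rModuli (modulusStep und)) (s := s)
    (fun i s' => (s'.reg rAns = 1 ↔ s.reg rAns = 1 ∨ ∃ r < i, ∃ j < R,
      ¬ ((x + j : ℕ) : ℤ) ∣
        walkSum (labelledArcs und U V m) r (Finset.range k) (Finset.range k) r) ∧
      ∀ p < 3 + 2 * m, s'.mem p = s.mem p) ?_ ?_
  · rw [hF.verts] at key
    exact key.1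
  · simp [State.set_reg]
  · rintro r hr s' hr' hrS ⟨i1, i2⟩
    rw [hF.verts] at hr
    have hF' : Fixed n m k R x s' := hF.congr fun r hr => hr' r (by
      cases und <;> interval_cases r <;> decide)
    have hW : ∀ v ∈ activeVerts U V m r, v < n := by
      rintro v (rfl | ⟨i, hi, rfl | rfl⟩)
      exacts [hr, hUn i hi, hVn i hi]
    have key' := loop_induction (w := w) (i := rJ) (n := rModuli)
      (c := modulusStep und) (s := s')
      (fun i t => (t.reg rAns = 1 ↔ s'.reg rAns = 1 ∨ ∃ j < i,
        ¬ ((x + j : ℕ) : ℤ) ∣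
          walkSum (labelledArcs und U V m) r (Finset.range k) (Finset.range k) r) ∧
        ∀ p < 3 + 2 * m, t.mem p = s.mem p) ?_ ?_
    · rw [hF'.moduli] at key'
      refine ⟨?_, key'.2⟩
      rw [State.set_reg, if_neg (by decide), key'.1, i1]
      constructor
      · rintro ((h | ⟨r', hr', h⟩) | h)
        · exact Or.inl h
        · exact Or.inr ⟨r', by omega, h⟩
        · exact Or.inr ⟨r, by omega, h⟩
      · rintro (h | ⟨r', hr', h⟩)
        · exact Or.inl (Or.inl h)
        · rcases Nat.lt_succ_iff_lt_or_eq.1 hr' with hr' | rfl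
          · exact Or.inl (Or.inr ⟨r', hr', h⟩)
          · exact Or.inr h
    · refine ⟨?_, i2⟩
      simp [State.set_reg]
    · rintro j hj t ht htJ ⟨j1, j2⟩
      rw [hF'.moduli] at hj
      obtain ⟨d1, d2⟩ := modulusStep_spec (und := und) (r := r) (j := j) t
        (hF'.congr fun r hr => ht r (by cases und <;> interval_cases r <;> decide)) hw
        ((ht _ (by cases und <;> decide)).trans hrS) htJ rfl
        (fun i hi => by rw [j2 _ (by omega), hU i hi])
        (fun i hi => by rw [j2 _ (by omega), hV i hi]) hW (by omega) (by omega) (by omega)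
      refine ⟨?_, fun p hp => by rw [State.set_mem, d2 p hp, j2 p hp]⟩
      rw [State.set_reg, if_neg (by decide), d1, j1]
      constructor
      · rintro ((h | ⟨i, hi, h⟩) | h)
        · exact Or.inl h
        · exact Or.inr ⟨i, by omega, h⟩
        · exact Or.inr ⟨j, by omega, h⟩
      · rintro (h | ⟨i, hi, h⟩)
        · exact Or.inl (Or.inl h)
        · rcases Nat.lt_succ_iff_lt_or_eq.1 hi with hi | rfl
          · exact Or.inl (Or.inr ⟨i, hi, h⟩)
          · exact Or.inr h

/-! ### Initialization of the program -/

/-- Read the parameters; answer YES if `k = 0` and there is a vertex. Without edges no start vertex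
is tried, since the time may then not depend on the number of vertices. -/
def readInput : Cmd := block [
  const rOne 1,
  const rZero 0,
  load rVerts rZero,
  load rEdges rOne,
  const rTmp 2,
  load rK rTmp,
  const rAns 0,
  ite rK rZero (ite rVerts rZero skip (const rAns 1)) skip,
  ite rEdges rZero (const rVerts 0) skip]

/-- Compute the constants of the main loop. -/
def setConstants : Cmd := block [
  op .add rBase rEdges rEdges,
  const rTmp 3,
  op .add rBase rBase rTmp,
  op .add rTmp rK rK,
  op .shl rMasks rOne rTmp,
  const rTmp 5,
  op .mul rModuli rK rK,
  op .mul rModuli rModuli rTmp,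
  op .mul rX rModuli rK,
  op .mul rX rX rEdges,
  op .add rX rX rX,
  op .add rX rX rEdges,
  const rTmp 2,
  op .add rX rX rTmp,
  op .add rModuli rModuli rOne]

/-- The number of moduli, `r + 1` for `r = 5 * k ^ 2`, the exponent in `walkSum_range_le`. -/
def numModuli (k : ℕ) : ℕ := k * k * 5 + 1

/-- The first modulus. It exceeds `r * (2 * m * k)` for `r = 5 * k ^ 2`, as
`Nat.eq_zero_of_forall_add_dvd` demands, as well as all labels and the number `1`. The form is that
in which the program computes it. -/
def firstModulus (m k : ℕ) : ℕ := k * k * 5 * k * m + k * k * 5 * k * m + m + 2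

theorem readInput_spec {w n m k : ℕ} (s : State) (hw : 2 < 2 ^ w) (hn : s.mem 0 = n)
    (hm : s.mem 1 = m) (hk : s.mem 2 = k) :
    let s' := readInput.eval w s
    s'.mem = s.mem ∧ s'.reg rOne = 1 ∧ s'.reg rZero = 0 ∧ s'.reg rEdges = m ∧ s'.reg rK = k ∧
      s'.reg rVerts = (if m = 0 then 0 else n) ∧ (s'.reg rAns = 1 ↔ k = 0 ∧ n ≠ 0) := by
  have e1 : 1 % 2 ^ w = 1 := Nat.mod_eq_of_lt (by omega)
  have e2 : 2 % 2 ^ w = 2 := Nat.mod_eq_of_lt hw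
  by_cases hk0 : k = 0 <;> by_cases hn0 : n = 0 <;> by_cases hm0 : m = 0 <;>
    simp [readInput, eval_block_cons, eval_block_nil,
      State.set_reg, State.set_mem, e1, e2, hn, hm, hk, hk0, hn0, hm0, eval]

theorem setConstants_spec {w N n m k : ℕ} (s : State)
    (hw : FitsWord w N m k (firstModulus m k + numModuli k)) (h1 : s.reg rOne = 1)
    (hz : s.reg rZero = 0) (hm : s.reg rEdges = m) (hk : s.reg rK = k) (hn : s.reg rVerts = n) :
    let s' := setConstants.eval w s
    s'.mem = s.mem ∧ Fixed n m k (numModuli k) (firstModulus m k) s' ∧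
      s'.reg rAns = s.reg rAns := by
  have haddr := hw.addr
  have hbits := hw.bits
  have hQ : firstModulus m k + numModuli k < 2 ^ w := by
    refine lt_of_lt_of_le ?_ hw.sq
    have : 2 ≤ firstModulus m k + numModuli k := by unfold firstModulus; omega
    nlinarith
  have hQ5 : 5 < 2 ^ w := by
    refine lt_of_lt_of_le ?_ hw.sq
    have : 3 ≤ firstModulus m k + numModuli k := by unfold firstModulus numModuli; omega
    nlinarith
  have hw2 : w < 2 ^ w := Nat.lt_two_pow_self
  unfold firstModulus numModuli at hQ
  have e1 : (m + m) % 2 ^ w = m + m := Nat.mod_eq_of_lt (by omega)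
  have e2 : 3 % 2 ^ w = 3 := Nat.mod_eq_of_lt (by omega)
  have e3 : (m + m + 3) % 2 ^ w = m + m + 3 := Nat.mod_eq_of_lt (by omega)
  have e4 : (k + k) % 2 ^ w = k + k := Nat.mod_eq_of_lt (by omega)
  have e5 : 1 <<< (k + k) % 2 ^ w = 2 ^ (2 * k) := by
    rw [Nat.one_shiftLeft, ← two_mul, Nat.mod_eq_of_lt (Nat.pow_lt_pow_right (by norm_num) hbits)]
  have e6 : 5 % 2 ^ w = 5 := Nat.mod_eq_of_lt hQ5
  have e7 : k * k % 2 ^ w = k * k := Nat.mod_eq_of_lt (by omega)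
  have e8 : k * k * 5 % 2 ^ w = k * k * 5 := Nat.mod_eq_of_lt (by omega)
  have e9 : m ≠ 0 → k * k * 5 * k ≤ k * k * 5 * k * m := fun h =>
    Nat.le_mul_of_pos_right _ (Nat.pos_of_ne_zero h)
  have e10 : k * k * 5 * k % 2 ^ w * m % 2 ^ w = k * k * 5 * k * m := by
    by_cases h : m = 0
    · simp [h]
    · rw [Nat.mod_eq_of_lt (a := k * k * 5 * k) (by have := e9 h; omega),
        Nat.mod_eq_of_lt (by omega)]
  have e11 : (k * k * 5 * k * m + k * k * 5 * k * m) % 2 ^ w =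
    k * k * 5 * k * m + k * k * 5 * k * m := Nat.mod_eq_of_lt (by omega)
  have e12 : (k * k * 5 * k * m + k * k * 5 * k * m + m) % 2 ^ w =
    k * k * 5 * k * m + k * k * 5 * k * m + m := Nat.mod_eq_of_lt (by omega)
  have e13 : 2 % 2 ^ w = 2 := Nat.mod_eq_of_lt (by omega)
  have e14 : (k * k * 5 * k * m + k * k * 5 * k * m + m + 2) % 2 ^ w =
    k * k * 5 * k * m + k * k * 5 * k * m + m + 2 := Nat.mod_eq_of_lt (by omega)
  have e15 : (k * k * 5 + 1) % 2 ^ w = k * k * 5 + 1 := Nat.mod_eq_of_lt (by omega)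
  refine ⟨eval_mem_of_storeless w _ (by simp [Storeless, setConstants, block]) s, ?_,
    eval_reg_of_notMem_writes w _ (by decide) s⟩
  have hreg : ∀ r ∉ setConstants.writes, (setConstants.eval w s).reg r = s.reg r :=
    fun r hr => eval_reg_of_notMem_writes w _ hr s
  refine ⟨(hreg _ (by decide)).trans h1, (hreg _ (by decide)).trans hz,
    (hreg _ (by decide)).trans hm, (hreg _ (by decide)).trans hk, (hreg _ (by decide)).trans hn,
    ?_, ?_, ?_, ?_⟩ <;>
  simp only [setConstants, eval_block_cons, eval_block_nil, eval_const, eval_op, Op.eval,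
    State.set_reg, h1, hm, hk, e1, e2, e3, e4, e5, e6, e7, e8, e10, e11,
    e12, e13, e14, e15, if_true, if_false, Nat.reduceEqDiff, OfNat.zero_ne_ofNat,
    numModuli, firstModulus]
  omega

/-! ### Running time -/

/-- The registers that bound the loops of the main loop. -/
def loopRegs : List ℕ := [rOne, rEdges, rK, rVerts, rMasks, rModuli]

theorem bounded_readInput : readInput.Bounded [] := by
  simp [Bounded, readInput, block]

theorem bounded_setConstants : setConstants.Bounded [] := by
  simp [Bounded, setConstants, block]

theorem bounded_mainLoop (und : Bool) : (mainLoop und).Bounded loopRegs := by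
  cases und <;>
    simp [Bounded, mainLoop, modulusStep, maskStep, storeCell, clearStep, fetchEdge, edgeStep,
      arcStep, lowStep, highStep, block, loopRegs, writes]

/-- The product of the numbers of rounds of the nested loops; the numerical constants are generous.
-/
theorem cost_mainLoop_le (und : Bool) (ρ : ℕ → ℕ) :
    (mainLoop und).cost ρ ≤
      2 + ρ rVerts * (5 + ρ rModuli *
        (ρ rMasks * ((ρ rEdges + 1) * (1000 * (ρ rK + 1) ^ 2)) + 100)) := by
  have h1 : highStep.cost ρ = 16 := by simp [highStep, cost, block]
  have h2 : lowStep.cost ρ ≤ 31 * (ρ rK + 1) := by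
    simp only [lowStep, cost, block, List.foldr, h1]; omega
  have h3 : ∀ u v, (arcStep u v).cost ρ ≤ 100 * (ρ rK + 1) ^ 2 := by
    intro u v
    simp only [arcStep, cost, block, List.foldr]
    nlinarith
  have h4 : (edgeStep und).cost ρ ≤ 210 * (ρ rK + 1) ^ 2 := by
    have h5 := h3 rU rV
    have h6 := h3 rV rU
    have h7 : 1 ≤ (ρ rK + 1) ^ 2 := Nat.one_le_pow _ _ (by omega)
    cases und
    · simp only [edgeStep, cost, block, List.foldr, fetchEdge, Bool.false_eq_true, if_false]
      omega
    · simp only [edgeStep, cost, block, List.foldr, fetchEdge, if_true]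
      omega
  have h7 : 1 ≤ (ρ rK + 1) ^ 2 := Nat.one_le_pow _ _ (by omega)
  have h8 : (maskStep und).cost ρ + 3 ≤ (ρ rEdges + 1) * (1000 * (ρ rK + 1) ^ 2) := by
    have h9 : ρ rEdges * ((edgeStep und).cost ρ + 3) ≤ ρ rEdges * (300 * (ρ rK + 1) ^ 2) :=
      Nat.mul_le_mul_left _ (by omega)
    simp only [maskStep, storeCell, clearStep, fetchEdge, cost, block, List.foldr]
    nlinarith
  have h10 : (modulusStep und).cost ρ + 3 ≤
      ρ rMasks * ((ρ rEdges + 1) * (1000 * (ρ rK + 1) ^ 2)) + 100 := by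
    have h9 := Nat.mul_le_mul_left (ρ rMasks) h8
    simp only [modulusStep, cost, block, List.foldr]
    omega
  have h11 := Nat.mul_le_mul_left (ρ rModuli) h10
  simp only [mainLoop, cost]
  refine Nat.add_le_add_left (Nat.mul_le_mul_left _ ?_) _
  omega

/-! ### The complete program -/

/-- The program for directed (`und = false`) and for undirected (`und = true`) graphs. -/
def circuitProgram (und : Bool) : Program :=
  (seq readInput setConstants).code 0 ++
    ((mainLoop und).code (seq readInput setConstants).len ++
      [.jeq rAns rOne ((seq readInput setConstants).len + (mainLoop und).len + 2),
        .halt false, .halt true])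

theorem deterministic_circuitProgram (und : Bool) : (circuitProgram und).Deterministic := by
  intro d
  simp [circuitProgram, coin_notMem_code]

theorem getD_flatMap_pair {n : ℕ} (es : List (Fin n × Fin n)) (i : ℕ) (hi : i < es.length) :
    (es.flatMap fun e => [e.1.val, e.2.val]).getD (2 * i) 0 = es[i].1.val ∧
      (es.flatMap fun e => [e.1.val, e.2.val]).getD (2 * i + 1) 0 = es[i].2.val := by
  induction es generalizing i with
  | nil => simp at hi
  | cons e es ih =>
    cases i with
    | zero => simp
    | succ i =>
      have := ih i (by simpa using hi)
      simpa [Nat.mul_succ] using this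

/-- The test made by the program: apart from the case `k = 0`, there is a suitable walk if and only
if one of the walk sums does not vanish, which is visible modulo one of the moduli. -/
theorem exists_nodup_walk_iff (und : Bool) (U V : ℕ → ℕ) (n m k : ℕ) :
    ((k = 0 ∧ n ≠ 0) ∨ ∃ r < if m = 0 then 0 else n, ∃ j < numModuli k,
      ¬ ((firstModulus m k + j : ℕ) : ℤ) ∣
        walkSum (labelledArcs und U V m) r (Finset.range k) (Finset.range k) r) ↔
    ∃ r < n, ∃ l ∈ walks (labelledArcs und U V m) r k r, l.Nodup := by
  constructor
  · rintro (⟨rfl, hn⟩ | ⟨r, hr, j, -, h⟩)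
    · exact ⟨0, Nat.pos_of_ne_zero hn, [], by simp [walks], List.nodup_nil⟩
    · refine ⟨r, by split_ifs at hr <;> omega, ?_⟩
      rw [← walkSum_range_ne_zero_iff]
      exact fun h0 => h (h0 ▸ dvd_zero _)
  · rintro ⟨r, hr, hl⟩
    rcases Nat.eq_zero_or_pos k with rfl | hk
    · exact Or.inl ⟨rfl, by omega⟩
    have hm : m ≠ 0 := by
      rintro rfl
      obtain ⟨k, rfl⟩ := Nat.exists_eq_succ_of_ne_zero hk.ne'
      simp [walks, labelledArcs] at hl
    rw [if_neg hm]
    refine Or.inr ⟨r, hr, ?_⟩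
    by_contra! hdvd
    rw [← walkSum_range_ne_zero_iff] at hl
    refine hl ?_
    have hle := walkSum_range_le (arcs := labelledArcs und U V m) (Nat.pos_of_ne_zero hm)
      (fun a ha => by
        obtain ⟨i, hi, rfl | ⟨-, rfl⟩⟩ := mem_labelledArcs.1 ha <;> exact hi.le)
      (length_labelledArcs_le und U V m) r k r
    have hnn := walkSum_range_nonneg (labelledArcs und U V m) r k r
    generalize walkSum (labelledArcs und U V m) r (Finset.range k) (Finset.range k) r = z at *
    lift z to ℕ using hnn
    rw [Nat.cast_eq_zero]
    refine Nat.eq_zero_of_forall_add_dvd (r := 5 * k ^ 2) (x := firstModulus m k)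
      (by exact_mod_cast hle) ?_ (by unfold firstModulus; omega) fun i hi => ?_
    · have : 5 * k ^ 2 * (2 * m * k) = k * k * 5 * k * m + k * k * 5 * k * m := by ring
      unfold firstModulus
      omega
    · exact_mod_cast hdvd i (by unfold numModuli; nlinarith)

/-- Everything is polynomial in `B = 2 ^ (k + log n + 1)`: the addresses are below `B ^ 20`, and the
moduli are at most `B ^ 10`. -/
theorem fitsWord_of_le {n m k w : ℕ} (hm : m ≤ n * n) (hw : 20 * (k + Nat.log 2 n + 1) ≤ w) :
    FitsWord w n m k (firstModulus m k + numModuli k) := by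
  obtain ⟨B, hB⟩ : ∃ B, B = 2 ^ (k + Nat.log 2 n + 1) := ⟨_, rfl⟩
  have hB2 : 2 ≤ B := by
    rw [hB, pow_succ]
    have := Nat.two_pow_pos (k + Nat.log 2 n)
    omega
  have hn : n ≤ B := (Nat.lt_pow_succ_log_self (b := 2) (by norm_num) n).le.trans
    (hB ▸ Nat.pow_le_pow_right (by norm_num) (by omega))
  have hk : 2 ^ k ≤ B := hB ▸ Nat.pow_le_pow_right (by norm_num) (by omega)
  have hk' : k ≤ B := Nat.lt_two_pow_self.le.trans hk
  have hm' : m ≤ B ^ 2 := hm.trans (by rw [sq]; exact Nat.mul_le_mul hn hn)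
  have hBw : B ^ 20 ≤ 2 ^ w := by
    rw [hB, ← pow_mul]
    exact Nat.pow_le_pow_right (by norm_num) (by omega)
  have h16 : 2 ^ 5 ≤ B ^ 5 := Nat.pow_le_pow_left hB2 5
  have p1 : B ^ 2 ≤ B ^ 5 := Nat.pow_le_pow_right (by omega) (by norm_num)
  have p2 : B ^ 3 ≤ B ^ 5 := Nat.pow_le_pow_right (by omega) (by norm_num)
  have p3 : B ^ 10 < B ^ 20 := Nat.pow_lt_pow_right (by omega) (by norm_num)
  have p4 : B ^ 10 = B ^ 5 * B ^ 5 := by ring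
  refine ⟨?_, ?_, by omega⟩
  · have h1 : n * 2 ^ (2 * k) ≤ B ^ 3 := by
      rw [mul_comm 2 k, pow_mul]
      calc n * (2 ^ k) ^ 2 ≤ B * B ^ 2 := Nat.mul_le_mul hn (Nat.pow_le_pow_left hk 2)
        _ = B ^ 3 := by ring
    nlinarith
  · have h1 : k * k * 5 * k * m ≤ 5 * B ^ 5 := by
      calc k * k * 5 * k * m ≤ B * B * 5 * B * B ^ 2 := by gcongr
        _ = 5 * B ^ 5 := by ring
    have h2 : k * k ≤ B ^ 2 := by rw [sq]; exact Nat.mul_le_mul hk' hk'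
    have h3 : firstModulus m k + numModuli k ≤ B ^ 10 := by
      unfold firstModulus numModuli
      nlinarith
    calc _ ≤ B ^ 10 * B ^ 10 := Nat.mul_le_mul h3 h3
      _ = B ^ 20 := by ring
      _ ≤ _ := hBw

/-- The running time of initialization and main loop. The factor `m + 1` in the loop over the edges
is at most `2 * m` unless there are no edges, and then there is no start vertex. -/
theorem time_le {n m k : ℕ} :
    60 + (2 + (if m = 0 then 0 else n) * (5 + numModuli k * (2 ^ (2 * k) * ((m + 1) *
      (1000 * (k + 1) ^ 2)) + 100))) ≤ 2 ^ (30 * (k + 1)) * (n * m + 1) := by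
  have hP : 2 ^ 30 ≤ 2 ^ (30 * (k + 1)) := Nat.pow_le_pow_right (by norm_num) (by omega)
  split_ifs with hm
  · rw [hm]
    omega
  · have hk : k + 1 ≤ 2 ^ (k + 1) := Nat.lt_two_pow_self.le
    have hk4 : (k + 1) ^ 4 ≤ 2 ^ (4 * (k + 1)) := by
      rw [mul_comm 4, pow_mul]
      exact Nat.pow_le_pow_left hk 4
    have hR : numModuli k ≤ 5 * (k + 1) ^ 2 := by unfold numModuli; nlinarith
    have hK : 1 ≤ 2 ^ (2 * k) := Nat.one_le_two_pow
    have hk1 : 1 ≤ (k + 1) ^ 2 := Nat.one_le_pow _ _ (by omega)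
    have hm1 : 1 ≤ m := Nat.pos_of_ne_zero hm
    have h1 : 1 ≤ 2 ^ (2 * k) * (m * (k + 1) ^ 2) := Nat.mul_pos hK (Nat.mul_pos hm1 hk1)
    have h2 : 2 ^ (2 * k) * ((m + 1) * (1000 * (k + 1) ^ 2)) + 100 ≤
        2100 * (2 ^ (2 * k) * (m * (k + 1) ^ 2)) := by
      have : 2 ^ (2 * k) * ((m + 1) * (1000 * (k + 1) ^ 2)) ≤
          2 ^ (2 * k) * ((m + m) * (1000 * (k + 1) ^ 2)) := by gcongr
      calc _ ≤ 2 ^ (2 * k) * ((m + m) * (1000 * (k + 1) ^ 2)) +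
            100 * (2 ^ (2 * k) * (m * (k + 1) ^ 2)) := by omega
        _ = _ := by ring
    have h3 : 5 + numModuli k * (2 ^ (2 * k) * ((m + 1) * (1000 * (k + 1) ^ 2)) + 100) ≤
        2 ^ 14 * (2 ^ (2 * k) * (m * (k + 1) ^ 4)) := by
      have h4 : 1 ≤ 2 ^ (2 * k) * (m * (k + 1) ^ 4) :=
        Nat.mul_pos hK (Nat.mul_pos hm1 (Nat.one_le_pow _ _ (by omega)))
      calc _ ≤ 5 * (2 ^ (2 * k) * (m * (k + 1) ^ 4)) +
            5 * (k + 1) ^ 2 * (2100 * (2 ^ (2 * k) * (m * (k + 1) ^ 2))) :=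
            Nat.add_le_add (by omega) (Nat.mul_le_mul hR h2)
        _ = 10505 * (2 ^ (2 * k) * (m * (k + 1) ^ 4)) := by ring
        _ ≤ _ := Nat.mul_le_mul_right _ (by norm_num)
    have h5 : 2 ^ 14 * (2 ^ (2 * k) * (m * (k + 1) ^ 4)) ≤ 2 ^ (30 * (k + 1)) * m :=
      calc 2 ^ 14 * (2 ^ (2 * k) * (m * (k + 1) ^ 4))
          ≤ 2 ^ 14 * (2 ^ (2 * k) * (m * 2 ^ (4 * (k + 1)))) := by gcongr
        _ = 2 ^ (14 + 2 * k + 4 * (k + 1)) * m := by rw [pow_add, pow_add]; ring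
        _ ≤ 2 ^ (30 * (k + 1)) * m :=
          Nat.mul_le_mul_right _ (Nat.pow_le_pow_right (by norm_num) (by omega))
    have h6 := Nat.mul_le_mul_left n (h3.trans h5)
    calc _ ≤ 60 + (2 + n * (2 ^ (30 * (k + 1)) * m)) := by omega
      _ ≤ 2 ^ (30 * (k + 1)) + n * (2 ^ (30 * (k + 1)) * m) := by omega
      _ = _ := by ring

/-- The program decides whether there is a closed walk with `k` arcs and distinct labels. -/
theorem decidesInTime_circuitProgram (und : Bool) {n k w : ℕ} {es : List (Fin n × Fin n)}
    (hes : es.Nodup) (hw : 20 * (k + Nat.log 2 n + 1) ≤ w) {A : Prop}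
    (hA : ∀ U V : ℕ → ℕ, (∀ i (h : i < es.length), U i = es[i].1) →
      (∀ i (h : i < es.length), V i = es[i].2) →
      (A ↔ ∃ r < n, ∃ l ∈ walks (labelledArcs und U V es.length) r k r, l.Nodup)) :
    DecidesInTime w (circuitProgram und) (encodeInput n es k) A
      (2 ^ (30 * (k + 1)) * (n * es.length + 1)) := by
  have hm : es.length ≤ n * n := by
    have := hes.length_le_card
    simpa using this
  have hfit := fitsWord_of_le hm hw
  have haddr := hfit.addr
  have hbits := hfit.bits
  have hw2 : w < 2 ^ w := Nat.lt_two_pow_self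
  have hnw : n < 2 ^ w := by
    have : n ≤ n * 2 ^ (2 * k) := Nat.le_mul_of_pos_right _ (Nat.two_pow_pos _)
    omega
  -- the initial memory
  obtain ⟨s₀, hs₀⟩ : ∃ s₀ : State, s₀ = ⟨fun _ => 0, (init w (encodeInput n es k)).mem⟩ := ⟨_, rfl⟩
  have hx : ∀ i, s₀.mem i = (encodeInput n es k).getD i 0 % 2 ^ w :=
    fun i => by rw [hs₀]; rfl
  have hx0 : s₀.mem 0 = n := by
    rw [hx]; exact Nat.mod_eq_of_lt hnw
  have hx1 : s₀.mem 1 = es.length := by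
    rw [hx]; exact Nat.mod_eq_of_lt (show es.length < 2 ^ w by omega)
  have hx2 : s₀.mem 2 = k := by
    rw [hx]; exact Nat.mod_eq_of_lt (show k < 2 ^ w by omega)
  have hxU : ∀ i (h : i < es.length), s₀.mem (3 + 2 * i) = es[i].1 := by
    intro i h
    rw [hx, add_comm 3]
    have := (getD_flatMap_pair es i h).1
    simp only [encodeInput, List.getD_cons_succ]
    rw [this, Nat.mod_eq_of_lt (es[i].1.2.trans hnw)]
  have hxV : ∀ i (h : i < es.length), s₀.mem (4 + 2 * i) = es[i].2 := by
    intro i h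
    rw [hx, show 4 + 2 * i = 2 * i + 1 + 3 by ring]
    have := (getD_flatMap_pair es i h).2
    simp only [encodeInput, List.getD_cons_succ]
    rw [this, Nat.mod_eq_of_lt (es[i].2.2.trans hnw)]
  rw [hA _ _ hxU hxV, ← exists_nodup_walk_iff]
  -- the effect of the three parts of the program
  obtain ⟨a1, a2, a3, a4, a5, a6, a7⟩ := readInput_spec (w := w) s₀ (by omega) hx0 hx1 hx2
  obtain ⟨b1, b2, b3⟩ := setConstants_spec (readInput.eval w s₀) hfit a2 a3 a4 a5 a6
  generalize hs₂ : setConstants.eval w (readInput.eval w s₀) = s₂ at *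
  have hmem₂ : s₂.mem = s₀.mem := b1.trans a1
  have hle : (if es.length = 0 then 0 else n) ≤ n := by split_ifs <;> omega
  have hfit' : FitsWord w (if es.length = 0 then 0 else n) es.length k
      (firstModulus es.length k + numModuli k) :=
    ⟨(Nat.add_le_add_left (Nat.mul_le_mul_right _ hle) _).trans_lt hfit.addr, hfit.sq, hfit.bits⟩
  have hmain := mainLoop_spec (und := und) (U := fun i => s₀.mem (3 + 2 * i))
    (V := fun i => s₀.mem (4 + 2 * i)) s₂ b2 hfit' (fun i _ => by rw [hmem₂])
    (fun i _ => by rw [hmem₂])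
    (fun i hi => by rw [if_neg (by omega), hxU i hi]; exact es[i].1.2)
    (fun i hi => by rw [if_neg (by omega), hxV i hi]; exact es[i].2.2)
    (by unfold firstModulus; omega) le_rfl (by unfold firstModulus; omega)
  rw [b3, a7] at hmain
  rw [← hmain]
  -- the run of the program
  have hcode : CodeAt (circuitProgram und) 0 (circuitProgram und) := fun i _ => by rw [zero_add]
  have hcode₁ := hcode.left
  have hcode₂ := hcode.right
  rw [length_code, zero_add] at hcode₂
  have hcode₃ := hcode₂.right
  rw [length_code] at hcode₃
  obtain ⟨t₁, ht₁, e₁⟩ := exists_iterate_step (w := w) (P := circuitProgram und) (L := [])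
    (ρ := fun _ => 0) (by simp) (by simp) (seq readInput setConstants)
    ⟨bounded_readInput, bounded_setConstants⟩ 0 hcode₁ s₀ (by simp)
  have hQ : firstModulus es.length k + numModuli k < 2 ^ w := by
    refine lt_of_lt_of_le ?_ hfit.sq
    have : 2 ≤ firstModulus es.length k + numModuli k := by unfold firstModulus; omega
    nlinarith
  obtain ⟨t₂, ht₂, e₂⟩ := exists_iterate_step (w := w) (P := circuitProgram und) (L := loopRegs)
    (ρ := s₂.reg) (by
      intro r hr
      simp only [loopRegs, List.mem_cons, List.not_mem_nil, or_false] at hr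
      rcases hr with rfl | rfl | rfl | rfl | rfl | rfl
      · rw [b2.one]; omega
      · rw [b2.edges]; omega
      · rw [b2.param]; omega
      · rw [b2.verts]; omega
      · rw [b2.masks]; exact Nat.pow_lt_pow_right (by norm_num) hbits
      · rw [b2.moduli]; omega) (fun _ => b2.one) (mainLoop und) (bounded_mainLoop und) _
    hcode₂.left s₂ (fun _ _ => rfl)
  have hcost := cost_mainLoop_le und s₂.reg
  rw [b2.verts, b2.moduli, b2.masks, b2.edges, b2.param] at hcost
  have htime := time_le (n := n) (m := es.length) (k := k)
  have hcost₁ : (seq readInput setConstants).cost (fun _ => 0) ≤ 40 := by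
    simp [readInput, setConstants, cost, block]
  have hev : (seq readInput setConstants).eval w s₀ = s₂ := hs₂
  rw [hev, zero_add] at e₁
  have hinit : (⟨0, s₀.reg, s₀.mem⟩ : Config) = init w (encodeInput n es k) := by rw [hs₀]; rfl
  refine decidesInTime_of_haltsWith fun ω => ⟨1 + (t₂ + t₁), by omega, ?_⟩
  have hrun : run w (circuitProgram und) (encodeInput n es k) ω (1 + (t₂ + t₁)) =
      step w (circuitProgram und) false
        ⟨(seq readInput setConstants).len + (mainLoop und).len,
          ((mainLoop und).eval w s₂).reg, ((mainLoop und).eval w s₂).mem⟩ := by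
    rw [run_eq_iterate (deterministic_circuitProgram und), Function.iterate_add_apply,
      Function.iterate_add_apply, ← hinit, e₁, e₂, Function.iterate_one]
  rw [step_of_getElem? (s := ⟨_, _, _⟩) hcode₃.head] at hrun
  have hone : ((mainLoop und).eval w s₂).reg rOne = 1 :=
    (eval_reg_of_notMem_writes w _ ((bounded_mainLoop und).notMem_writes (by decide)) s₂).trans
      b2.one
  simp only [exec, hone] at hrun
  unfold HaltsWith
  rw [hrun]
  by_cases hans : ((mainLoop und).eval w s₂).reg rAns = 1
  · refine ⟨true, ?_, by simp [hans]⟩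
    rw [if_pos hans]
    exact hcode₃.tail.tail.head
  · refine ⟨false, ?_, by simp [hans]⟩
    rw [if_neg hans]
    exact hcode₃.tail.head

end WordRAM

theorem proposition4p2 :
    -- directed graphs, expected time
    (∃ (P : WordRAM.Program) (c a : ℕ),
      ∀ (n : ℕ) (G : Digraph (Fin n)) (_ : ∀ v, ¬ G.Adj v v)
        (es : List (Fin n × Fin n)) (_ : ListsArcs G es)
        (k w : ℕ) (_ : a * (k + Nat.log 2 n + 1) ≤ w),
        WordRAM.DecidesInExpectedTime w P (encodeInput n es k) (HasDirectedCircuit G k)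
          (2 ^ (c * (k + 1)) * (n * (arcSet G).ncard + 1))) ∧
    -- directed graphs, worst-case time
    (∃ (P : WordRAM.Program) (c a : ℕ), P.Deterministic ∧
      ∀ (n : ℕ) (G : Digraph (Fin n)) (_ : ∀ v, ¬ G.Adj v v)
        (es : List (Fin n × Fin n)) (_ : ListsArcs G es)
        (k w : ℕ) (_ : a * (k + Nat.log 2 n + 1) ≤ w),
        WordRAM.DecidesInTime w P (encodeInput n es k) (HasDirectedCircuit G k)
          (2 ^ (c * (k + 1)) * (n * (arcSet G).ncard * Nat.log 2 n + 1))) ∧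
    -- undirected graphs, expected time
    (∃ (P : WordRAM.Program) (c a : ℕ),
      ∀ (n : ℕ) (G : SimpleGraph (Fin n))
        (es : List (Fin n × Fin n)) (_ : ListsEdges G es)
        (k w : ℕ) (_ : a * (k + Nat.log 2 n + 1) ≤ w),
        WordRAM.DecidesInExpectedTime w P (encodeInput n es k) (HasCircuit G k)
          (2 ^ (c * (k + 1)) * (n * G.edgeSet.ncard + 1))) ∧
    -- undirected graphs, worst-case time
    (∃ (P : WordRAM.Program) (c a : ℕ), P.Deterministic ∧
      ∀ (n : ℕ) (G : SimpleGraph (Fin n))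
        (es : List (Fin n × Fin n)) (_ : ListsEdges G es)
        (k w : ℕ) (_ : a * (k + Nat.log 2 n + 1) ≤ w),
        WordRAM.DecidesInTime w P (encodeInput n es k) (HasCircuit G k)
          (2 ^ (c * (k + 1)) * (n * G.edgeSet.ncard * Nat.log 2 n + 1))) := by
  -- An edge needs two vertices, so that `Nat.log 2 n` is positive unless `m = 0`.
  have hlog : ∀ {n : ℕ} {es : List (Fin n × Fin n)}, (∀ e ∈ es, e.1 ≠ e.2) →
      n * es.length ≤ n * es.length * Nat.log 2 n := by
    intro n es hes
    rcases es with - | ⟨e, es⟩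
    · simp
    · have hn : 2 ≤ n := by
        have h1 := hes e (by simp)
        have h2 := e.1.2
        have h3 := e.2.2
        by_contra hn
        exact h1 (Fin.ext (by omega))
      exact Nat.le_mul_of_pos_right _ (Nat.log_pos (by norm_num) hn)
  have hD : ∀ (n : ℕ) (G : Digraph (Fin n)) (es : List (Fin n × Fin n)), ListsArcs G es →
      ∀ k w : ℕ, 20 * (k + Nat.log 2 n + 1) ≤ w →
      WordRAM.DecidesInTime w (WordRAM.circuitProgram false) (encodeInput n es k)
        (HasDirectedCircuit G k) (2 ^ (30 * (k + 1)) * (n * es.length + 1)) :=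
    fun n G es hes k w hw => WordRAM.decidesInTime_circuitProgram false hes.1 hw
      fun U V hU hV => hasDirectedCircuit_iff hes hU hV k
  have hU : ∀ (n : ℕ) (G : SimpleGraph (Fin n)) (es : List (Fin n × Fin n)), ListsEdges G es →
      ∀ k w : ℕ, 20 * (k + Nat.log 2 n + 1) ≤ w →
      WordRAM.DecidesInTime w (WordRAM.circuitProgram true) (encodeInput n es k)
        (HasCircuit G k) (2 ^ (30 * (k + 1)) * (n * es.length + 1)) :=
    fun n G es hes k w hw => WordRAM.decidesInTime_circuitProgram true hes.1.of_map hw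
      fun U V hU hV => hasCircuit_iff hes hU hV k
  refine ⟨⟨WordRAM.circuitProgram false, 30, 20, fun n G _ es hes k w hw => ?_⟩,
    ⟨WordRAM.circuitProgram false, 30, 20, WordRAM.deterministic_circuitProgram false,
      fun n G hG es hes k w hw => ?_⟩,
    ⟨WordRAM.circuitProgram true, 30, 20, fun n G es hes k w hw => ?_⟩,
    ⟨WordRAM.circuitProgram true, 30, 20, WordRAM.deterministic_circuitProgram true,
      fun n G es hes k w hw => ?_⟩⟩
  · rw [← hes.length_eq]
    exact (hD n G es hes k w hw).decidesInExpectedTime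
  · rw [← hes.length_eq]
    refine (hD n G es hes k w hw).mono (Nat.mul_le_mul_left _ (Nat.succ_le_succ (hlog ?_)))
    intro e he hee
    have hadj : G.Adj e.1 e.2 := (hes.2 e).1 he
    rw [← hee] at hadj
    exact hG _ hadj
  · rw [← hes.length_eq]
    exact (hU n G es hes k w hw).decidesInExpectedTime
  · rw [← hes.length_eq]
    refine (hU n G es hes k w hw).mono (Nat.mul_le_mul_left _ (Nat.succ_le_succ (hlog ?_)))
    intro e he
    have hadj : G.Adj e.1 e.2 := (hes.2 _).1 (List.mem_map.2 ⟨e, he, rfl⟩)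
    exact hadj.ne
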